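/- Let $\mathbb{X}$ be a finite alphabet with $D$ letters and let $(X_i)_{i\in\mathbb{Z}}$ be a stationary process of $\mathbb{X}$-valued random variables on a probability space with measure $P$; write $X_n^m=(X_i)_{n\le i\le m}$. Assume that the process is a finite-energy process, i.e. there are constants $c<1$ and $K$ such that $P(X_{t+|w|+1}^{t+|w|+|u|}=u\mid X_{t+1}^{t+|w|}=w)\le Kc^{|u|}$ for all $t\in\mathbb{Z}$ and all finite (possibly empty) strings $u,w$ over $\mathbb{X}$ with $P(X_{t+1}^{t+|w|}=w)>0$. Let $E_\mu(n)=H_P(X_1^n)+H_P(X_{n+1}^{2n})-H_P(X_1^{2n})$ be its $n$-symbol excess entropy, where $H_P$ is the Shannon entropy. Suppose that $$\liminf_{n\to\infty}\frac{E_\mu(n)}{n^\beta}>0\quad\text{for some }\beta\in(0,1).$$ Then $$\limsup_{n\to\infty}\mathbf{E}_P\left(\frac{V[\Gamma(X_1^n)]}{n^\beta(\log n)^{-1}}\right)^p>0$$ for every $p>1$ and every admissibly minimal grammar transform $\Gamma$. (Both limits are taken in $[-\infty,\infty]$.) Here a grammar is a set of rules $G=\{A_1\to\alpha_1,\dots,A_m\to\alpha_m\}$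 with $m\ge1$, start symbol $A_1$ and $\alpha_i\in(\{A_{i+1},\dots,A_m\}\cup\mathbb{X})^*$, and $V[G]=m$ is its vocabulary size. A grammar transform is a function $\Gamma$ that assigns to each nonempty string $w$ over $\mathbb{X}$ a grammar $\Gamma(w)$ that generates the language $\{w\}$. It is called admissibly minimal if, for some numbering $e:\mathbb{X}\to\{0,\dots,D-1\}$ (a bijection) and some code $\varphi:\{0,1,2,\dots\}\to\{0,1\}^*$ that is prefix-free, has nondecreasing codeword lengths and satisfies $|\varphi(k)|/\log_2 k\to1$ as $k\to\infty$, one has $\|\Gamma(w)\|\le\|G\|$ for each nonempty string $w$ and each grammar $G$ that generates $\{w\}$. Here $\|G\|$ is the length of the binary string obtained by applying $\varphi$ symbol by symbol to the string of numbers $$F_1(\alpha_1)\,D\,F_2(\alpha_2)\,D\cdots D\,F_m(\alpha_m)\,(D+1),$$ where $F_i$ replaces each letter $x$ by $e(x)$ and each nonterminal $A_j$ by $D+1+j-i$. -/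

import Mathlib

open MeasureTheory ProbabilityTheory Filter Topology

noncomputable section

namespace Herdan

/-! ### Processes, entropy, excess entropy -/

section Blocks

variable {Ω 𝕏 : Type*}

/-- The block `X_{t+1}^{t+n} = (X_{t+1}, …, X_{t+n})`. -/
def block (X : ℤ → Ω → 𝕏) (t : ℤ) (n : ℕ) (ω : Ω) : Fin n → 𝕏 :=
  fun i => X (t + 1 + (i : ℕ)) ω

/-- The process is (strictly) stationary: its distribution on `ℤ → 𝕏` is shift invariant. -/
def IsStationary [MeasurableSpace Ω] [MeasurableSpace 𝕏] (P : Measure Ω) (X : ℤ → Ω → 𝕏) : Prop :=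
  P.map (fun ω (i : ℤ) => X (i + 1) ω) = P.map (fun ω (i : ℤ) => X i ω)

/-- Finite-energy process: there are constants `c < 1` and `K` with
`P(X_{t+m+1}^{t+m+k} = u | X_{t+1}^{t+m} = w) ≤ K c ^ k` for all `t`, all strings `w` of length `m`
and `u` of length `k` (possibly empty) such that the conditioning event has positive probability. -/
def IsFiniteEnergy [MeasurableSpace Ω] (P : Measure Ω) (X : ℤ → Ω → 𝕏) : Prop :=
  ∃ c K : ℝ, c < 1 ∧ ∀ (t : ℤ) (m k : ℕ) (w : Fin m → 𝕏) (u : Fin k → 𝕏),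
    0 < P (block X t m ⁻¹' {w}) →
      (P[|block X t m ⁻¹' {w}]).real (block X (t + m) k ⁻¹' {u}) ≤ K * c ^ k

/-- Shannon entropy `-E log P(Y)` (in nats) of a random variable with finitely many values. -/
def entropy [MeasurableSpace Ω] {α : Type*} [Fintype α] (P : Measure Ω) (Y : Ω → α) : ℝ :=
  ∑ y, Real.negMulLog (P.real (Y ⁻¹' {y}))

/-- The `n`-symbol excess entropy
`E(n) = I(X_1^n ; X_{n+1}^{2n}) = H(X_1^n) + H(X_{n+1}^{2n}) - H(X_1^{2n})`. -/
def excessEntropy [MeasurableSpace Ω] [Fintype 𝕏] (P : Measure Ω) (X : ℤ → Ω → 𝕏) (n : ℕ) : ℝ :=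
  entropy P (block X 0 n) + entropy P (block X n n) - entropy P (block X 0 (2 * n))

end Blocks

/-! ### Admissible grammars -/

/-- A grammar `{A_1 → α_1, …, A_n → α_n}` with exactly one rule per nonterminal, start symbol `A_1`
and `α_i ∈ ({A_{i+1}, …, A_n} ∪ 𝕏)^*`. The nonterminal `A_{i+1}` is represented by `i : Fin n`. -/
structure Grammar (𝕏 : Type*) where
  /-- the number `n` of nonterminals -/
  size : ℕ
  size_pos : 0 < size
  /-- the right-hand sides -/
  rhs : Fin size → List (Symbol 𝕏 (Fin size))
  succeeding : ∀ i j : Fin size, Symbol.nonterminal j ∈ rhs i → i < j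

namespace Grammar

variable {𝕏 : Type*}

/-- The underlying context-free grammar. -/
def toCFG (G : Grammar 𝕏) : ContextFreeGrammar 𝕏 where
  NT := Fin G.size
  initial := ⟨0, G.size_pos⟩
  rules := Finset.univ.map
    ⟨fun i => ⟨i, G.rhs i⟩, fun _ _ h => congrArg ContextFreeRule.input h⟩

/-- `G` generates the singleton language `{w}`. -/
def Produces (G : Grammar 𝕏) (w : List 𝕏) : Prop :=
  G.toCFG.language = {w}

/-- The vocabulary size: the number of distinct nonterminals, including the start symbol. -/
def vocabularySize (G : Grammar 𝕏) : ℕ := G.size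

variable [Fintype 𝕏]

/-- The number of a symbol on the right-hand side of the rule for `A_i`, for an alphabet of
`D` letters numbered `0, …, D - 1` by `e`: a letter is mapped to its number and `A_j` to
`D + 1 + (j - i)` (always `j > i`, so that the numbers `D` and `D + 1` stay free). -/
def symbolNumber (e : 𝕏 ≃ Fin (Fintype.card 𝕏)) {n : ℕ} (i : Fin n) : Symbol 𝕏 (Fin n) → ℕ
  | .terminal x => e x
  | .nonterminal j => Fintype.card 𝕏 + 1 + ((j : ℕ) - (i : ℕ))

/-- The grammar as a string of natural numbers: the right-hand sides of its rules in their order,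
each followed by a comma `D`, except for the last one, which is followed by the end mark `D + 1`. -/
def numbers (e : 𝕏 ≃ Fin (Fintype.card 𝕏)) (G : Grammar 𝕏) : List ℕ :=
  (List.ofFn fun i : Fin G.size =>
    (G.rhs i).map (symbolNumber e i) ++
      [if (i : ℕ) + 1 = G.size then Fintype.card 𝕏 + 1 else Fintype.card 𝕏]).flatten

/-- The local binary encoding of a grammar, its numbers being written with the code `φ`. -/
def encode (e : 𝕏 ≃ Fin (Fintype.card 𝕏)) (φ : ℕ → List Bool) (G : Grammar 𝕏) : List Bool :=
  (G.numbers e).flatMap φ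

/-- The length `‖G‖` of the binary encoding of `G`. -/
def codeLength (e : 𝕏 ≃ Fin (Fintype.card 𝕏)) (φ : ℕ → List Bool) (G : Grammar 𝕏) : ℕ :=
  (G.encode e φ).length

end Grammar

/-- An asymptotically optimal prefix-free binary code for the natural numbers, with codeword lengths
that do not decrease (for instance Elias' omega code). -/
structure IsProperNumberCode (φ : ℕ → List Bool) : Prop where
  prefix_free : ∀ m n, φ m <+: φ n → m = n
  length_mono : Monotone fun n => (φ n).length
  length_asymp : Tendsto (fun n : ℕ => ((φ n).length : ℝ) / Real.logb 2 n) atTop (𝓝 1)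

section Transform

variable {𝕏 : Type*}

/-- A grammar transform: `Γ w` generates `{w}` for each nonempty string `w`. -/
def IsGrammarTransform (Γ : List 𝕏 → Grammar 𝕏) : Prop :=
  ∀ w : List 𝕏, w ≠ [] → (Γ w).Produces w

/-- An admissibly minimal grammar transform: for some numbering of the letters and some proper
number code, `Γ w` has the shortest binary encoding among all grammars that generate `{w}`,
for each nonempty string `w`. -/
def IsAdmissiblyMinimal [Fintype 𝕏] (Γ : List 𝕏 → Grammar 𝕏) : Prop :=
  IsGrammarTransform Γ ∧
    ∃ (e : 𝕏 ≃ Fin (Fintype.card 𝕏)) (φ : ℕ → List Bool), IsProperNumberCode φ ∧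
      ∀ w : List 𝕏, w ≠ [] → ∀ G : Grammar 𝕏, G.Produces w →
        (Γ w).codeLength e φ ≤ G.codeLength e φ

end Transform

end Herdan

end

/-! Let C(w) be the length of the binary code of Γ(w); compare its mean with the entropy H along n =
2^k. The codes of distinct words of equal length form a prefix code, so the mean of C, in nats, is
at least H (`kraft_codeLength`, `entropy_le_integral_length`). Grammars with one nonterminal per
block of a fixed length, the likelier blocks getting smaller numbers, show that C attains the
entropy rate (`integral_codeLength_le`). So the redundancy per letter is nonnegative and tends to 0
along powers of two; it cannot increase strictly from some point on, and therefore the mean of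
C(X_1^n) + C(X_{n+1}^{2n}) - C(X_1^{2n}) is infinitely often at least the excess entropy of order
n^β (`frequently_excess_le`).

The same difference is bounded above through the vocabulary. If no string of length l occurs twice
in w = uv, a nonterminal with an expansion of length at least l that occurs in w has a single
position there, so its rule can be cut at the boundary of u and v without new nonterminals; shorter
nonterminals are kept for u and written out in letters for v. Each rule costs O(l + log n) extra
bits, whence C(u) + C(v) - C(uv) ≤ V · O(l + log n) (`codeLength_add_codeLength_le`).

Finite energy allows l = O(log n) outside an event of probability O(1/n)
(`measureReal_not_noRepeat_le`), on which the trivial bound C = O(n) contributes only a constant.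
Hence the mean vocabulary size is infinitely often at least of order n^β / log n, and Jensen's
inequality passes to p-th moments. -/

namespace Herdan

/-! ### Words derived by grammars, and the cost of rules. -/

namespace Grammar

variable {𝕏 : Type*}

/-- The word derived from the nonterminal `i`. -/
def expand (G : Grammar 𝕏) (i : Fin G.size) : List 𝕏 :=
  (G.rhs i).attach.flatMap fun s => match s with
    | ⟨.terminal x, _⟩ => [x]
    | ⟨.nonterminal j, _⟩ => expand G j
termination_by G.size - i
decreasing_by
  have := G.succeeding i j ‹_›
  have := j.isLt
  omega

/-- The word derived from a symbol. -/
def expandSymbol (G : Grammar 𝕏) : Symbol 𝕏 (Fin G.size) → List 𝕏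
  | .terminal x => [x]
  | .nonterminal j => G.expand j

lemma expand_eq (G : Grammar 𝕏) (i : Fin G.size) :
    G.expand i = (G.rhs i).flatMap G.expandSymbol := by
  rw [expand]
  conv_rhs => rw [← List.attach_map_subtype_val (G.rhs i)]
  rw [List.flatMap_map]
  congr 1
  funext ⟨s, hs⟩
  cases s <;> rfl

lemma expandSymbol_flatMap_terminal (G : Grammar 𝕏) (w : List 𝕏) :
    (w.map Symbol.terminal).flatMap G.expandSymbol = w := by
  induction w with
  | nil => rfl
  | cons x w ih => simp [expandSymbol] at ih ⊢; exact ih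

/-- Downward induction on nonterminals. -/
lemma nonterminal_induction (G : Grammar 𝕏) {p : Fin G.size → Prop}
    (h : ∀ i, (∀ j, Symbol.nonterminal j ∈ G.rhs i → p j) → p i) (i : Fin G.size) : p i := by
  have key : ∀ n : ℕ, ∀ i : Fin G.size, G.size - i ≤ n → p i := by
    intro n
    induction n with
    | zero => intro i hi; have := i.isLt; omega
    | succ n ih =>
      intro i hi
      refine h i fun j hj => ih j ?_
      have := G.succeeding i j hj
      have := j.isLt
      omega
  exact key _ i le_rfl

/-- One step of rewriting a string of symbols. -/
def Step (G : Grammar 𝕏) (l l' : List (Symbol 𝕏 (Fin G.size))) : Prop :=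
  ∃ (i : Fin G.size) (p q : List (Symbol 𝕏 (Fin G.size))),
    l = p ++ [Symbol.nonterminal i] ++ q ∧ l' = p ++ G.rhs i ++ q

lemma toCFG_produces_iff (G : Grammar 𝕏) (l l' : List (Symbol 𝕏 (Fin G.size))) :
    G.toCFG.Produces l l' ↔ G.Step l l' := by
  constructor
  · rintro ⟨r, hr, hrw⟩
    obtain ⟨i, -, rfl⟩ := Finset.mem_map.mp hr
    obtain ⟨p, q, hp, hq⟩ := hrw.exists_parts
    exact ⟨i, p, q, hp, hq⟩
  · rintro ⟨i, p, q, hp, hq⟩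
    refine ⟨⟨i, G.rhs i⟩, Finset.mem_map.mpr ⟨i, Finset.mem_univ _, rfl⟩, ?_⟩
    exact ContextFreeRule.rewrites_iff.mpr ⟨p, q, hp, hq⟩

lemma toCFG_derives_iff (G : Grammar 𝕏) (l l' : List (Symbol 𝕏 (Fin G.size))) :
    G.toCFG.Derives l l' ↔ Relation.ReflTransGen G.Step l l' := by
  have : G.toCFG.Produces = G.Step := by
    funext l l'
    exact propext (G.toCFG_produces_iff l l')
  unfold ContextFreeGrammar.Derives
  rw [this]
  rfl

lemma Step.append (G : Grammar 𝕏) {l l' : List (Symbol 𝕏 (Fin G.size))} (h : G.Step l l')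
    (a b : List (Symbol 𝕏 (Fin G.size))) : G.Step (a ++ l ++ b) (a ++ l' ++ b) := by
  obtain ⟨i, p, q, rfl, rfl⟩ := h
  exact ⟨i, a ++ p, q ++ b, by simp, by simp⟩

lemma reflTransGen_append (G : Grammar 𝕏) {l l' : List (Symbol 𝕏 (Fin G.size))}
    (h : Relation.ReflTransGen G.Step l l') (a b : List (Symbol 𝕏 (Fin G.size))) :
    Relation.ReflTransGen G.Step (a ++ l ++ b) (a ++ l' ++ b) := by
  induction h with
  | refl => exact .refl
  | tail _ hs ih => exact ih.tail (hs.append G a b)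

lemma reflTransGen_flatMap (G : Grammar 𝕏) {l : List (Symbol 𝕏 (Fin G.size))}
    (h : ∀ s ∈ l, Relation.ReflTransGen G.Step [s] ((G.expandSymbol s).map Symbol.terminal)) :
    Relation.ReflTransGen G.Step l ((l.flatMap G.expandSymbol).map Symbol.terminal) := by
  induction l with
  | nil => exact .refl
  | cons s l ih =>
    have h1 := G.reflTransGen_append (h s (by simp)) [] l
    have h2 := G.reflTransGen_append (ih fun t ht => h t (by simp [ht]))
      ((G.expandSymbol s).map Symbol.terminal) []
    simp only [List.nil_append, List.append_nil, List.singleton_append] at h1 h2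
    rw [List.flatMap_cons, List.map_append]
    exact h1.trans h2

lemma reflTransGen_expand (G : Grammar 𝕏) (i : Fin G.size) :
    Relation.ReflTransGen G.Step [Symbol.nonterminal i] ((G.expand i).map Symbol.terminal) := by
  induction i using G.nonterminal_induction with
  | h i ih =>
    have hstep : G.Step [Symbol.nonterminal i] (G.rhs i) := ⟨i, [], [], by simp, by simp⟩
    refine .head hstep ?_
    rw [expand_eq]
    refine G.reflTransGen_flatMap fun s hs => ?_
    cases s with
    | terminal x => exact .refl
    | nonterminal j => exact ih j hs

/-- The full expansion is an invariant of rewriting, so a grammar derives at most one terminal word.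
-/
lemma flatMap_expandSymbol_eq (G : Grammar 𝕏) {l l' : List (Symbol 𝕏 (Fin G.size))}
    (h : Relation.ReflTransGen G.Step l l') :
    l.flatMap G.expandSymbol = l'.flatMap G.expandSymbol := by
  induction h with
  | refl => rfl
  | tail _ hs ih =>
    obtain ⟨i, p, q, rfl, rfl⟩ := hs
    rw [ih]
    simp [expandSymbol, G.expand_eq i]

lemma produces_iff (G : Grammar 𝕏) (w : List 𝕏) :
    G.Produces w ↔ G.expand ⟨0, G.size_pos⟩ = w := by
  have hmem : ∀ v : List 𝕏, v ∈ G.toCFG.language ↔ G.expand ⟨0, G.size_pos⟩ = v := by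
    intro v
    refine (G.toCFG.mem_language_iff v).trans
      ((G.toCFG_derives_iff [Symbol.nonterminal ⟨0, G.size_pos⟩] _).trans ?_)
    constructor
    · intro h
      have h1 := G.flatMap_expandSymbol_eq h
      have h2 := h1.trans (G.expandSymbol_flatMap_terminal v)
      simpa [expandSymbol] using h2
    · rintro rfl
      exact G.reflTransGen_expand _
  unfold Produces
  constructor
  · intro h
    rw [← hmem, h]
    rfl
  · rintro rfl
    ext v
    rw [hmem]
    exact eq_comm

variable [Fintype 𝕏]

/-- The number of binary digits of the symbol `s` in the rule of the nonterminal `i`. -/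
def symbolCost (e : 𝕏 ≃ Fin (Fintype.card 𝕏)) (φ : ℕ → List Bool) {n : ℕ} (i : Fin n)
    (s : Symbol 𝕏 (Fin n)) : ℕ :=
  (φ (symbolNumber e i s)).length

/-- The length of the code of the mark after the rule of the nonterminal `i` of `n`. -/
def separatorCost (𝕏 : Type*) [Fintype 𝕏] (φ : ℕ → List Bool) (n : ℕ) (i : Fin n) : ℕ :=
  (φ (if (i : ℕ) + 1 = n then Fintype.card 𝕏 + 1 else Fintype.card 𝕏)).length

lemma codeLength_eq (e : 𝕏 ≃ Fin (Fintype.card 𝕏)) (φ : ℕ → List Bool) (G : Grammar 𝕏) :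
    G.codeLength e φ = ∑ i : Fin G.size,
      (((G.rhs i).map (symbolCost e φ i)).sum + separatorCost 𝕏 φ G.size i) := by
  unfold codeLength encode numbers
  rw [List.flatMap_def, List.length_flatten, List.map_map, List.map_flatten, List.sum_flatten,
    List.map_map, List.map_ofFn, List.sum_ofFn]
  refine Finset.sum_congr rfl fun i _ => ?_
  simp +unfoldPartialApp [symbolCost, separatorCost, Function.comp_def]

lemma symbolCost_terminal_le (e : 𝕏 ≃ Fin (Fintype.card 𝕏)) {φ : ℕ → List Bool}
    (hφ : IsProperNumberCode φ) {n : ℕ} (i : Fin n) (x : 𝕏) :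
    symbolCost e φ i (.terminal x) ≤ (φ (Fintype.card 𝕏 + 1)).length := by
  apply hφ.length_mono
  simp only [symbolNumber]
  have := (e x).isLt
  omega

lemma symbolCost_nonterminal_le (e : 𝕏 ≃ Fin (Fintype.card 𝕏)) {φ : ℕ → List Bool}
    (hφ : IsProperNumberCode φ) {n : ℕ} (i j : Fin n) :
    symbolCost e φ i (.nonterminal j) ≤ (φ (Fintype.card 𝕏 + 1 + n)).length := by
  apply hφ.length_mono
  simp only [symbolNumber]
  have := j.isLt
  omega

lemma separatorCost_le {φ : ℕ → List Bool} (hφ : IsProperNumberCode φ) {n : ℕ} (i : Fin n) :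
    separatorCost 𝕏 φ n i ≤ (φ (Fintype.card 𝕏 + 1)).length := by
  apply hφ.length_mono
  split_ifs <;> omega

lemma sum_symbolCost_terminal_le (e : 𝕏 ≃ Fin (Fintype.card 𝕏)) {φ : ℕ → List Bool}
    (hφ : IsProperNumberCode φ) {n : ℕ} (i : Fin n) (w : List 𝕏) :
    ((w.map Symbol.terminal).map (symbolCost e φ i)).sum ≤
      (φ (Fintype.card 𝕏 + 1)).length * w.length := by
  rw [List.map_map]
  induction w with
  | nil => simp
  | cons x w ih =>
    simp only [List.map_cons, List.sum_cons, List.length_cons, Function.comp_apply]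
    have := symbolCost_terminal_le e hφ i x
    rw [mul_add, mul_one]
    simp only [Function.comp_def] at ih ⊢
    omega

end Grammar

lemma IsProperNumberCode.length_pos {φ : ℕ → List Bool} (hφ : IsProperNumberCode φ) (n : ℕ) :
    0 < (φ n).length := by
  rw [List.length_pos_iff]
  intro h
  have h1 := hφ.prefix_free n (n + 1) (by rw [h]; exact List.nil_prefix)
  omega

/-- Every rule ends with a mark, and no codeword is empty. -/
lemma Grammar.size_le_codeLength {𝕏 : Type*} [Fintype 𝕏] (e : 𝕏 ≃ Fin (Fintype.card 𝕏))
    {φ : ℕ → List Bool} (hφ : IsProperNumberCode φ) (G : Grammar 𝕏) :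
    G.size ≤ G.codeLength e φ := by
  rw [G.codeLength_eq]
  calc G.size = ∑ i : Fin G.size, 1 := by simp
    _ ≤ _ := Finset.sum_le_sum fun i _ => by
      have : 0 < separatorCost 𝕏 φ G.size i := hφ.length_pos _
      omega

/-- The grammar with one rule. -/
def flatGrammar {𝕏 : Type*} (w : List 𝕏) : Grammar 𝕏 where
  size := 1
  size_pos := one_pos
  rhs _ := w.map Symbol.terminal
  succeeding i j h := by simp at h

lemma flatGrammar_produces {𝕏 : Type*} (w : List 𝕏) : (flatGrammar w).Produces w := by
  rw [Grammar.produces_iff, Grammar.expand_eq]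
  exact Grammar.expandSymbol_flatMap_terminal _ w

lemma codeLength_flatGrammar_le {𝕏 : Type*} [Fintype 𝕏] (e : 𝕏 ≃ Fin (Fintype.card 𝕏))
    {φ : ℕ → List Bool} (hφ : IsProperNumberCode φ) (w : List 𝕏) :
    (flatGrammar w).codeLength e φ ≤ (φ (Fintype.card 𝕏 + 1)).length * (w.length + 1) := by
  rw [Grammar.codeLength_eq]
  have h0 : ∀ i : Fin (flatGrammar w).size, (((flatGrammar w).rhs i).map
      (Grammar.symbolCost e φ i)).sum + Grammar.separatorCost 𝕏 φ (flatGrammar w).size i ≤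
      (φ (Fintype.card 𝕏 + 1)).length * (w.length + 1) := by
    intro i
    rw [mul_add, mul_one]
    exact add_le_add (Grammar.sum_symbolCost_terminal_le e hφ i w) (Grammar.separatorCost_le hφ i)
  calc _ ≤ ∑ i : Fin (flatGrammar w).size, (φ (Fintype.card 𝕏 + 1)).length * (w.length + 1) :=
        Finset.sum_le_sum fun i _ => h0 i
    _ = _ := by
      rw [Finset.sum_const, Finset.card_univ, Fintype.card_fin]
      simp [flatGrammar]

/-! ### Splitting a list of symbols at a position of its expansion -/

section Split

variable {σ 𝕏 : Type*} (f : σ → List 𝕏) (long : σ → Prop) [DecidablePred long]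
  (flat : List 𝕏 → List σ)

/-- The symbols of a list up to the position `k` of its expansion. A symbol which contains this
position is kept if it is long, else it is replaced with a part of its expansion. -/
def splitLeft : ℕ → List σ → List σ
  | _, [] => []
  | k, s :: l =>
    (if (f s).length ≤ k then [s] else if k = 0 then [] else if long s then [s]
      else flat ((f s).take k)) ++ splitLeft (k - (f s).length) l

/-- The symbols of a list after the position `k` of its expansion. A symbol which contains this
position is kept if it is long, else it is replaced with a part of its expansion. -/
def splitRight : ℕ → List σ → List σ
  | _, [] => []
  | k, s :: l =>
    (if (f s).length ≤ k then [] else if k = 0 then [s] else if long s then [s]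
      else flat ((f s).drop k)) ++ splitRight (k - (f s).length) l

variable {f long flat}

lemma mem_splitLeft {k : ℕ} {l : List σ} {s : σ} (hs : s ∈ splitLeft f long flat k l) :
    s ∈ l ∨ ∃ x, s ∈ flat x := by
  induction l generalizing k with
  | nil => simp [splitLeft] at hs
  | cons t l ih =>
    rw [splitLeft, List.mem_append] at hs
    rcases hs with hs | hs
    · split_ifs at hs
      · simp at hs; simp [hs]
      · simp at hs
      · simp at hs; simp [hs]
      · exact .inr ⟨_, hs⟩
    · rcases ih hs with h | h
      · simp [h]
      · exact .inr h

lemma mem_splitRight {k : ℕ} {l : List σ} {s : σ} (hs : s ∈ splitRight f long flat k l) :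
    s ∈ l ∨ ∃ x, s ∈ flat x := by
  induction l generalizing k with
  | nil => simp [splitRight] at hs
  | cons t l ih =>
    rw [splitRight, List.mem_append] at hs
    rcases hs with hs | hs
    · split_ifs at hs
      · simp at hs
      · simp at hs; simp [hs]
      · simp at hs; simp [hs]
      · exact .inr ⟨_, hs⟩
    · rcases ih hs with h | h
      · simp [h]
      · exact .inr h

/-- Here `f` is the expansion in the old grammar and `g` that in the new one, where long symbols are
themselves already cut at the same place, at an offset depending on what precedes them. -/
lemma flatMap_splitLeft {g : σ → List 𝕏} (hflat : ∀ x, (flat x).flatMap g = x) {k : ℕ} {l : List σ}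
    (hshort : ∀ s ∈ l, ¬ long s → g s = f s)
    (hlong : ∀ p s q, l = p ++ s :: q → long s →
      g s = (f s).take (k - (p.flatMap f).length)) :
    (splitLeft f long flat k l).flatMap g = (l.flatMap f).take k := by
  induction l generalizing k with
  | nil => simp [splitLeft]
  | cons s l ih =>
    have hs : long s → g s = (f s).take k := fun h => by simpa using hlong [] s l rfl h
    have hs' : ¬ long s → g s = f s := hshort s (by simp)
    rw [splitLeft, List.flatMap_append, List.flatMap_cons, List.take_append,
      ih (fun t ht => hshort t (by simp [ht])) ?_]
    · congr 1
      split_ifs with h1 h2 h3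
      · by_cases h : long s
        · simp [hs h]
        · simp [hs' h, List.take_of_length_le h1]
      · simp [h2]
      · simp [hs h3]
      · exact hflat _
    · intro p t q hpq ht
      rw [hlong (s :: p) t q (by simp [hpq]) ht]
      congr 1
      rw [List.flatMap_cons, List.length_append]
      omega

lemma flatMap_splitRight {g : σ → List 𝕏} (hflat : ∀ x, (flat x).flatMap g = x) {k : ℕ}
    {l : List σ} (hshort : ∀ s ∈ l, ¬ long s → g s = f s)
    (hlong : ∀ p s q, l = p ++ s :: q → long s →
      g s = (f s).drop (k - (p.flatMap f).length)) :
    (splitRight f long flat k l).flatMap g = (l.flatMap f).drop k := by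
  induction l generalizing k with
  | nil => simp [splitRight]
  | cons s l ih =>
    have hs : long s → g s = (f s).drop k := fun h => by simpa using hlong [] s l rfl h
    have hs' : ¬ long s → g s = f s := hshort s (by simp)
    rw [splitRight, List.flatMap_append, List.flatMap_cons, List.drop_append,
      ih (fun t ht => hshort t (by simp [ht])) ?_]
    · congr 1
      split_ifs with h1 h2 h3
      · simp [List.drop_of_length_le h1]
      · by_cases h : long s
        · simp [hs h]
        · simp [hs' h, h2]
      · simp [hs h3]
      · exact hflat _
    · intro p t q hpq ht
      rw [hlong (s :: p) t q (by simp [hpq]) ht]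
      congr 1
      rw [List.flatMap_cons, List.length_append]
      omega

/-- Only the symbol straddling position `k` can contribute to both sides. If long, it is paid twice;
if short, it is replaced by letters at price `W` each. For `k = 0` nothing straddles. -/
lemma sum_splitLeft_add_sum_splitRight_le {c : σ → ℕ} {B W k : ℕ} {l : List σ}
    (hflat : ∀ x, ((flat x).map c).sum ≤ W * x.length)
    (hshort : ∀ s ∈ l, ¬ long s → W * (f s).length ≤ B) (hlong : ∀ s ∈ l, long s → c s ≤ B) :
    ((splitLeft f long flat k l).map c).sum + ((splitRight f long flat k l).map c).sum ≤
      (l.map c).sum + if k = 0 then 0 else B := by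
  induction l generalizing k with
  | nil => simp [splitLeft, splitRight]
  | cons s l ih =>
    have ih' := ih (k := k - (f s).length) (fun t ht => hshort t (by simp [ht]))
      (fun t ht => hlong t (by simp [ht]))
    simp only [splitLeft, splitRight, List.map_append, List.sum_append, List.map_cons,
      List.sum_cons]
    have hm : k = 0 → k - (f s).length = 0 := by omega
    by_cases h1 : (f s).length ≤ k
    · simp only [h1, if_true, List.map_cons, List.map_nil, List.sum_cons, List.sum_nil]
      split_ifs at ih' ⊢ <;> omega
    · have h0 : k - (f s).length = 0 := by omega
      rw [if_pos h0] at ih'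
      by_cases h2 : k = 0
      · rw [if_neg h1, if_neg h1, if_pos h2, if_pos h2, if_pos h2]
        simp only [List.map_cons, List.map_nil, List.sum_cons, List.sum_nil]
        omega
      · by_cases h3 : long s
        · have := hlong s (by simp) h3
          simp only [h1, h2, h3, if_true, if_false, List.map_cons, List.map_nil, List.sum_cons,
            List.sum_nil]
          omega
        · have h4 := hshort s (by simp) h3
          have h5 := hflat ((f s).take k)
          have h6 := hflat ((f s).drop k)
          have h7 : W * ((f s).take k).length + W * ((f s).drop k).length = W * (f s).length := by
            rw [← mul_add, ← List.length_append, List.take_append_drop]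
          simp only [h1, h2, h3, if_false]
          omega

end Split

/-! ### Splitting a grammar -/

/-- No string of length `l` has two occurrences in `w`. -/
def NoRepeat {𝕏 : Type*} (l : ℕ) (w : List 𝕏) : Prop :=
  ∀ (a b : ℕ) (x : List 𝕏), x.length = l → x <+: w.drop a → x <+: w.drop b → a = b

lemma NoRepeat.eq_of_le {𝕏 : Type*} {l : ℕ} {w : List 𝕏} (h : NoRepeat l w) {a b : ℕ} {x : List 𝕏}
    (hx : l ≤ x.length) (ha : x <+: w.drop a) (hb : x <+: w.drop b) : a = b :=
  h a b (x.take l) (by simp [hx]) ((List.take_prefix l x).trans ha)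
    ((List.take_prefix l x).trans hb)

namespace Grammar

variable {𝕏 : Type*} (G : Grammar 𝕏)

/-- The symbol is a nonterminal which derives a word of length at least `l`. -/
def IsLong (l : ℕ) : Symbol 𝕏 (Fin G.size) → Prop
  | .terminal _ => False
  | .nonterminal j => l ≤ (G.expand j).length

open Classical in
/-- A position at which the expansion of the nonterminal `i` occurs in `w`. -/
noncomputable def position (w : List 𝕏) (i : Fin G.size) : ℕ :=
  if h : ∃ a, G.expand i <+: w.drop a then h.choose else 0

lemma position_eq {w : List 𝕏} {l : ℕ} (hw : NoRepeat l w) {i : Fin G.size}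
    (hi : l ≤ (G.expand i).length) {a : ℕ} (ha : G.expand i <+: w.drop a) :
    G.position w i = a := by
  have h : ∃ a, G.expand i <+: w.drop a := ⟨a, ha⟩
  rw [position, dif_pos h]
  exact hw.eq_of_le hi h.choose_spec ha

open Classical in
/-- The grammar for the part of `w` before the position `k`. -/
noncomputable abbrev left (l : ℕ) (w : List 𝕏) (k : ℕ) : Grammar 𝕏 where
  size := G.size
  size_pos := G.size_pos
  rhs i := if l ≤ (G.expand i).length then
      splitLeft G.expandSymbol (G.IsLong l) (List.map Symbol.terminal) (k - G.position w i)
        (G.rhs i)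
    -- A short nonterminal keeps its rule on this side only. In the other half it is written out in
    -- letters, since duplicating its rule could cost arbitrarily much while its expansion has fewer
    -- than `l` letters.
    else G.rhs i
  succeeding i j h := by
    split_ifs at h
    · rcases mem_splitLeft h with h | ⟨x, h⟩
      · exact G.succeeding i j h
      · simp at h
    · exact G.succeeding i j h

open Classical in
/-- The grammar for the part of `w` after the position `k`. -/
noncomputable abbrev right (l : ℕ) (w : List 𝕏) (k : ℕ) : Grammar 𝕏 where
  size := G.size
  size_pos := G.size_pos
  rhs i := if l ≤ (G.expand i).length then
      splitRight G.expandSymbol (G.IsLong l) (List.map Symbol.terminal) (k - G.position w i)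
        (G.rhs i)
    else (G.expand i).map Symbol.terminal
  succeeding i j h := by
    split_ifs at h
    · rcases mem_splitRight h with h | ⟨x, h⟩
      · exact G.succeeding i j h
      · simp at h
    · simp at h

variable {G}

lemma length_expandSymbol_le {i : Fin G.size} {s : Symbol 𝕏 (Fin G.size)} (hs : s ∈ G.rhs i) :
    (G.expandSymbol s).length ≤ (G.expand i).length := by
  rw [expand_eq, List.length_flatMap]
  exact List.single_le_sum (fun _ _ => Nat.zero_le _) _ (List.mem_map_of_mem hs)

lemma prefix_drop_of_split {w : List 𝕏} {a : ℕ} {i : Fin G.size} (ha : G.expand i <+: w.drop a)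
    {p q : List (Symbol 𝕏 (Fin G.size))} {s : Symbol 𝕏 (Fin G.size)}
    (h : G.rhs i = p ++ s :: q) :
    G.expandSymbol s <+: w.drop (a + (p.flatMap G.expandSymbol).length) := by
  rw [expand_eq, h, List.flatMap_append, List.flatMap_cons] at ha
  obtain ⟨r, hr⟩ := ha
  rw [← List.drop_drop, ← hr, List.append_assoc, List.drop_left, List.append_assoc]
  exact List.prefix_append _ _

/-- Both claims go through one downward induction: short rules contain only short symbols, and a
long symbol inside a long rule sits at a position computed from that of the rule. The truncated `k -
a` also covers occurrences starting after the cut, which become empty. -/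
lemma expand_left {w : List 𝕏} {l : ℕ} (hw : NoRepeat l w) (k : ℕ) (i : Fin G.size) :
    ((G.expand i).length < l → (G.left l w k).expand i = G.expand i) ∧
    (l ≤ (G.expand i).length → ∀ a, G.expand i <+: w.drop a →
      (G.left l w k).expand i = (G.expand i).take (k - a)) := by
  classical
  induction i using G.nonterminal_induction with
  | h i ih =>
    have hshort : ∀ s ∈ G.rhs i, ¬ G.IsLong l s →
        (G.left l w k).expandSymbol s = G.expandSymbol s := by
      intro s hs hl
      cases s with
      | terminal x => rfl
      | nonterminal j => exact (ih j hs).1 (not_le.mp hl)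
    constructor
    · intro hi
      have hrhs : (G.left l w k).rhs i = G.rhs i := if_neg (not_le.mpr hi)
      rw [(G.left l w k).expand_eq, hrhs, G.expand_eq]
      refine List.flatMap_congr fun s hs => hshort s hs fun hl => ?_
      have := length_expandSymbol_le hs
      cases s with
      | terminal x => exact hl
      | nonterminal j =>
        have h2 : l ≤ (G.expandSymbol (.nonterminal j)).length := hl
        omega
    · intro hi a ha
      have hrhs : (G.left l w k).rhs i = splitLeft G.expandSymbol (G.IsLong l)
        (List.map Symbol.terminal) (k - G.position w i) (G.rhs i) := if_pos hi
      rw [(G.left l w k).expand_eq, hrhs, G.position_eq hw hi ha,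
        flatMap_splitLeft (expandSymbol_flatMap_terminal _) hshort ?_, ← G.expand_eq]
      intro p s q hpq hs
      cases s with
      | terminal x => exact hs.elim
      | nonterminal j =>
        refine ((ih j (by simp [hpq])).2 hs _ (prefix_drop_of_split ha hpq)).trans ?_
        rw [Nat.sub_sub]
        rfl

lemma expand_right {w : List 𝕏} {l : ℕ} (hw : NoRepeat l w) (k : ℕ) (i : Fin G.size) :
    ((G.expand i).length < l → (G.right l w k).expand i = G.expand i) ∧
    (l ≤ (G.expand i).length → ∀ a, G.expand i <+: w.drop a →
      (G.right l w k).expand i = (G.expand i).drop (k - a)) := by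
  classical
  induction i using G.nonterminal_induction with
  | h i ih =>
    constructor
    · intro hi
      have hrhs : (G.right l w k).rhs i = (G.expand i).map Symbol.terminal :=
        if_neg (not_le.mpr hi)
      rw [(G.right l w k).expand_eq, hrhs]
      exact expandSymbol_flatMap_terminal _ _
    · intro hi a ha
      have hrhs : (G.right l w k).rhs i = splitRight G.expandSymbol (G.IsLong l)
        (List.map Symbol.terminal) (k - G.position w i) (G.rhs i) := if_pos hi
      rw [(G.right l w k).expand_eq, hrhs, G.position_eq hw hi ha,
        flatMap_splitRight (expandSymbol_flatMap_terminal _) ?_ ?_, ← G.expand_eq]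
      · intro s hs hl
        cases s with
        | terminal x => rfl
        | nonterminal j => exact (ih j hs).1 (not_le.mp hl)
      · intro p s q hpq hs
        cases s with
        | terminal x => exact hs.elim
        | nonterminal j =>
          refine ((ih j (by simp [hpq])).2 hs _ (prefix_drop_of_split ha hpq)).trans ?_
          rw [Nat.sub_sub]
          rfl

lemma left_produces {u v : List 𝕏} {l : ℕ} (hG : G.Produces (u ++ v))
    (hw : NoRepeat l (u ++ v)) (hl : l ≤ (u ++ v).length) :
    (G.left l (u ++ v) u.length).Produces u := by
  rw [produces_iff] at hG ⊢
  refine ((expand_left hw u.length ⟨0, G.size_pos⟩).2 (hG ▸ hl) 0 (by rw [hG]; simp)).trans ?_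
  rw [hG]
  simp

lemma right_produces {u v : List 𝕏} {l : ℕ} (hG : G.Produces (u ++ v))
    (hw : NoRepeat l (u ++ v)) (hl : l ≤ (u ++ v).length) :
    (G.right l (u ++ v) u.length).Produces v := by
  rw [produces_iff] at hG ⊢
  refine ((expand_right hw u.length ⟨0, G.size_pos⟩).2 (hG ▸ hl) 0 (by rw [hG]; simp)).trans ?_
  rw [hG]
  simp

/-- Each rule pays for at most one straddling symbol or one written-out short word, plus one extra
separator. Rules of nonterminals absent from `w` get the default position 0; this is harmless, as
the cost bound holds for any cutting position. -/
lemma codeLength_left_add_codeLength_right_le [Fintype 𝕏] (e : 𝕏 ≃ Fin (Fintype.card 𝕏))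
    {φ : ℕ → List Bool} (hφ : IsProperNumberCode φ) (w : List 𝕏) {l : ℕ} (hl : 1 ≤ l) (k : ℕ) :
    (G.left l w k).codeLength e φ + (G.right l w k).codeLength e φ ≤
      G.codeLength e φ + G.size * ((φ (Fintype.card 𝕏 + 1)).length * (l + 1) +
        (φ (Fintype.card 𝕏 + 1 + G.size)).length) := by
  classical
  set W := (φ (Fintype.card 𝕏 + 1)).length with hW
  set B := (φ (Fintype.card 𝕏 + 1 + G.size)).length with hB
  have hsep : ∀ i : Fin G.size, separatorCost 𝕏 φ G.size i ≤ W := fun i => separatorCost_le hφ i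
  have key : ∀ i : Fin G.size,
      (((G.left l w k).rhs i).map (symbolCost e φ i)).sum +
        (((G.right l w k).rhs i).map (symbolCost e φ i)).sum ≤
      ((G.rhs i).map (symbolCost e φ i)).sum + (W * l + B) := by
    intro i
    by_cases hi : l ≤ (G.expand i).length
    · have h1 : (G.left l w k).rhs i = splitLeft G.expandSymbol (G.IsLong l)
        (List.map Symbol.terminal) (k - G.position w i) (G.rhs i) := if_pos hi
      have h2 : (G.right l w k).rhs i = splitRight G.expandSymbol (G.IsLong l)
        (List.map Symbol.terminal) (k - G.position w i) (G.rhs i) := if_pos hi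
      rw [h1, h2]
      refine (sum_splitLeft_add_sum_splitRight_le (B := W * l + B) (W := W)
        (fun x => sum_symbolCost_terminal_le e hφ i x) ?_ ?_).trans ?_
      · intro s _ hs
        have : (G.expandSymbol s).length ≤ l := by
          cases s with
          | terminal x => exact hl
          | nonterminal j => exact (not_le.mp hs).le
        exact (Nat.mul_le_mul_left W this).trans (Nat.le_add_right _ _)
      · intro s _ hs
        cases s with
        | terminal x => exact hs.elim
        | nonterminal j =>
          exact (symbolCost_nonterminal_le e hφ i j).trans (Nat.le_add_left _ _)
      · split_ifs <;> omega
    · have h1 : (G.left l w k).rhs i = G.rhs i := if_neg hi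
      have h2 : (G.right l w k).rhs i = (G.expand i).map Symbol.terminal := if_neg hi
      rw [h1, h2]
      have h3 : (((G.expand i).map Symbol.terminal).map (symbolCost e φ i)).sum ≤
        W * (G.expand i).length := sum_symbolCost_terminal_le e hφ i (G.expand i)
      have h4 := Nat.mul_le_mul_left W (not_le.mp hi).le
      omega
  rw [codeLength_eq, codeLength_eq, codeLength_eq]
  have hc : ∀ b : ℕ, ∑ _i : Fin G.size, b = G.size * b := by simp
  rw [← hc]
  change (∑ i : Fin G.size, _) + (∑ i : Fin G.size, _) ≤ _
  rw [← Finset.sum_add_distrib, ← Finset.sum_add_distrib]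
  refine Finset.sum_le_sum fun i _ => ?_
  have h1 := key i
  have h2 := hsep i
  have h3 : W * (l + 1) = W * l + W := by ring
  change _ + separatorCost 𝕏 φ G.size i + (_ + separatorCost 𝕏 φ G.size i) ≤ _
  omega

end Grammar

/-- The codes of the halves of a word without long repeats are not much longer than the code
of the word, in comparison to the vocabulary size. -/
lemma codeLength_add_codeLength_le {𝕏 : Type*} [Fintype 𝕏] {Γ : List 𝕏 → Grammar 𝕏}
    (hΓ : IsGrammarTransform Γ) (e : 𝕏 ≃ Fin (Fintype.card 𝕏)) {φ : ℕ → List Bool}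
    (hφ : IsProperNumberCode φ)
    (hmin : ∀ w : List 𝕏, w ≠ [] → ∀ G : Grammar 𝕏, G.Produces w →
      (Γ w).codeLength e φ ≤ G.codeLength e φ) {u v : List 𝕏} (hu : u ≠ []) (hv : v ≠ [])
    {l : ℕ} (hl : 1 ≤ l) (hl' : l ≤ (u ++ v).length) (hw : NoRepeat l (u ++ v)) :
    (Γ u).codeLength e φ + (Γ v).codeLength e φ ≤ (Γ (u ++ v)).codeLength e φ +
      (Γ (u ++ v)).size * ((φ (Fintype.card 𝕏 + 1)).length * (l + 1) +
        (φ (Fintype.card 𝕏 + 1 + (Γ (u ++ v)).size)).length) := by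
  have hG := hΓ (u ++ v) (by simp [hu])
  exact (add_le_add (hmin u hu _ (Grammar.left_produces hG hw hl'))
    (hmin v hv _ (Grammar.right_produces hG hw hl'))).trans
    (Grammar.codeLength_left_add_codeLength_right_le e hφ _ hl _)

/-! ### Prefix codes -/

/-- The two first codewords are prefixes of a common list, hence comparable, hence equal; strip them
and repeat. -/
lemma prefix_of_flatten_prefix {α : Type*} {S : Set (List α)}
    (hS : ∀ a ∈ S, ∀ b ∈ S, a <+: b → a = b) (h0 : [] ∉ S) {L L' : List (List α)}
    (hL : ∀ a ∈ L, a ∈ S) (hL' : ∀ a ∈ L', a ∈ S) (h : L.flatten <+: L'.flatten) : L <+: L' := by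
  induction L generalizing L' with
  | nil => exact List.nil_prefix
  | cons a L ih =>
    have ha := hL a (by simp)
    cases L' with
    | nil =>
      simp at h
      exact (h0 (h.1 ▸ ha)).elim
    | cons b L' =>
      have hb := hL' b (by simp)
      rw [List.flatten_cons, List.flatten_cons] at h
      have hab : a = b := by
        rcases List.prefix_or_prefix_of_prefix ((List.prefix_append a _).trans h)
          (List.prefix_append b _) with h1 | h1
        · exact hS a ha b hb h1
        · exact (hS b hb a ha h1).symm
      subst hab
      rw [List.prefix_append_right_inj] at h
      rw [List.prefix_cons_inj]
      exact ih (fun c hc => hL c (by simp [hc])) (fun c hc => hL' c (by simp [hc])) h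

lemma uniquelyDecodable_of_prefix_free {α : Type*} {S : Set (List α)}
    (hS : ∀ a ∈ S, ∀ b ∈ S, a <+: b → a = b) (h0 : [] ∉ S) :
    InformationTheory.UniquelyDecodable S := by
  intro L L' hL hL' h
  have h1 := prefix_of_flatten_prefix hS h0 hL hL' (h ▸ List.prefix_refl _)
  have h2 := prefix_of_flatten_prefix hS h0 hL' hL (h ▸ List.prefix_refl _)
  exact h1.eq_of_length (le_antisymm h1.length_le h2.length_le)

lemma IsProperNumberCode.prefix_of_flatMap_prefix {φ : ℕ → List Bool} (hφ : IsProperNumberCode φ)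
    {l l' : List ℕ} (h : l.flatMap φ <+: l'.flatMap φ) : l <+: l' := by
  have hinj : Function.Injective φ := fun m n hmn => hφ.prefix_free m n (hmn ▸ List.prefix_refl _)
  have h1 : l.map φ <+: l'.map φ := by
    refine prefix_of_flatten_prefix (S := Set.range φ) ?_ ?_ (by simp) (by simp)
      (by simpa [List.flatMap_def] using h)
    · rintro _ ⟨m, rfl⟩ _ ⟨n, rfl⟩ hmn
      rw [hφ.prefix_free m n hmn]
    · rintro ⟨n, hn⟩
      have := hφ.length_pos n
      simp [hn] at this
  obtain ⟨r, hr⟩ := h1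
  obtain ⟨l₁, l₂, h2, h3, -⟩ := List.map_eq_append_iff.mp hr.symm
  rw [h2]
  rw [(List.map_injective_iff.mpr hinj) h3]
  exact List.prefix_append _ _

/-! ### The numbers of a grammar determine it, in a prefix-free way. -/

namespace Grammar

variable {𝕏 : Type*} [Fintype 𝕏]

lemma symbolNumber_ne {e : 𝕏 ≃ Fin (Fintype.card 𝕏)} {G : Grammar 𝕏} {i : Fin G.size}
    {s : Symbol 𝕏 (Fin G.size)} (hs : s ∈ G.rhs i) :
    symbolNumber e i s ≠ Fintype.card 𝕏 ∧ symbolNumber e i s ≠ Fintype.card 𝕏 + 1 := by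
  cases s with
  | terminal x =>
    have := (e x).isLt
    simp only [symbolNumber]
    omega
  | nonterminal j =>
    have : (i : ℕ) < j := G.succeeding i j hs
    simp only [symbolNumber]
    omega

lemma symbolNumber_injOn {e : 𝕏 ≃ Fin (Fintype.card 𝕏)} {m : ℕ} {i : Fin m}
    {s t : Symbol 𝕏 (Fin m)} (hs : ∀ j, s = .nonterminal j → i < j)
    (ht : ∀ j, t = .nonterminal j → i < j) (h : symbolNumber e i s = symbolNumber e i t) :
    s = t := by
  cases s with
  | terminal x =>
    have hx := (e x).isLt
    cases t with
    | terminal y =>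
      simp only [symbolNumber] at h
      rw [e.injective (Fin.ext h)]
    | nonterminal j =>
      simp only [symbolNumber] at h
      omega
  | nonterminal k =>
    have hk : (i : ℕ) < k := hs k rfl
    cases t with
    | terminal y =>
      have hx := (e y).isLt
      simp only [symbolNumber] at h
      omega
    | nonterminal j =>
      have hj : (i : ℕ) < j := ht j rfl
      simp only [symbolNumber] at h
      congr 1
      apply Fin.ext
      omega

lemma eq_of_map_symbolNumber_eq {e : 𝕏 ≃ Fin (Fintype.card 𝕏)} {m : ℕ} {i : Fin m}
    {l l' : List (Symbol 𝕏 (Fin m))} (hl : ∀ j, .nonterminal j ∈ l → i < j)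
    (hl' : ∀ j, .nonterminal j ∈ l' → i < j)
    (h : l.map (symbolNumber e i) = l'.map (symbolNumber e i)) : l = l' := by
  induction l generalizing l' with
  | nil => simpa using h.symm
  | cons s l ih =>
    cases l' with
    | nil => simp at h
    | cons t l' =>
      simp only [List.map_cons, List.cons.injEq] at h
      rw [symbolNumber_injOn (fun j hj => hl j (by simp [hj]))
        (fun j hj => hl' j (by simp [hj])) h.1,
        ih (fun j hj => hl j (by simp [hj])) (fun j hj => hl' j (by simp [hj])) h.2]

/-- The marks D and D + 1 never number a symbol, so the rules with their marks are words of the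
prefix-free set `S`. The end mark D + 1 then forces equal sizes, and the rules agree one by one. -/
lemma eq_of_numbers_prefix {e : 𝕏 ≃ Fin (Fintype.card 𝕏)} {G G' : Grammar 𝕏}
    (h : G.numbers e <+: G'.numbers e) : G = G' := by
  let S : Set (List ℕ) := {x | ∃ a c, x = a ++ [c] ∧
    (∀ y ∈ a, y ≠ Fintype.card 𝕏 ∧ y ≠ Fintype.card 𝕏 + 1) ∧
    (c = Fintype.card 𝕏 ∨ c = Fintype.card 𝕏 + 1)}
  let piece : (G : Grammar 𝕏) → Fin G.size → List ℕ := fun G i =>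
    (G.rhs i).map (symbolNumber e i) ++ [if (i : ℕ) + 1 = G.size then Fintype.card 𝕏 + 1
      else Fintype.card 𝕏]
  have hpiece : ∀ (G : Grammar 𝕏), ∀ x ∈ List.ofFn (piece G), x ∈ S := by
    intro G x hx
    obtain ⟨i, rfl⟩ := (List.mem_ofFn' _ _).mp hx
    refine ⟨_, _, rfl, ?_, ?_⟩
    · intro y hy
      obtain ⟨s, hs, rfl⟩ := List.mem_map.mp hy
      exact symbolNumber_ne hs
    · split_ifs <;> simp
  have hpre : List.ofFn (piece G) <+: List.ofFn (piece G') := by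
    refine prefix_of_flatten_prefix (S := S) ?_ ?_ (hpiece G) (hpiece G') h
    · rintro _ ⟨a, c, rfl, -, hc⟩ _ ⟨b, d, rfl, hb, -⟩ hab
      rcases List.prefix_concat_iff.mp hab with h1 | h1
      · exact h1
      · have := hb c (h1.subset (by simp))
        omega
    · rintro ⟨a, c, h, -⟩
      simp at h
  have hle : G.size ≤ G'.size := by simpa using hpre.length_le
  have hget : ∀ i : Fin G.size, piece G i = piece G' (Fin.castLE hle i) := by
    intro i
    have := hpre.getElem (i := i) (by simp)
    rwa [List.getElem_ofFn, List.getElem_ofFn] at this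
  have hsize : G.size = G'.size := by
    have h1 := hget ⟨G.size - 1, by have := G.size_pos; omega⟩
    have h2 := (List.append_inj' h1 rfl).2
    have h3 := G.size_pos
    simp only [Fin.castLE_mk, List.cons.injEq, and_true] at h2
    rw [if_pos (by omega)] at h2
    by_contra hne
    rw [if_neg (by omega)] at h2
    omega
  obtain ⟨m, hm, r, hr⟩ := G
  obtain ⟨m', hm', r', hr'⟩ := G'
  obtain rfl : m = m' := hsize
  congr 1
  funext i
  exact eq_of_map_symbolNumber_eq (hr i) (hr' i) (List.append_inj' (hget i) rfl).1

end Grammar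

/-! ### Kraft's inequality for grammar codes. -/

section Kraft

variable {𝕏 : Type*} [Fintype 𝕏]

lemma eq_of_encode_prefix {Γ : List 𝕏 → Grammar 𝕏} (hΓ : IsGrammarTransform Γ)
    (e : 𝕏 ≃ Fin (Fintype.card 𝕏)) {φ : ℕ → List Bool} (hφ : IsProperNumberCode φ)
    {u v : List 𝕏} (hu : u ≠ []) (hv : v ≠ [])
    (h : (Γ u).encode e φ <+: (Γ v).encode e φ) : u = v := by
  have h1 := Grammar.eq_of_numbers_prefix (hφ.prefix_of_flatMap_prefix h)
  have h2 := (Grammar.produces_iff _ _).mp (hΓ u hu)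
  have h3 := (Grammar.produces_iff _ _).mp (hΓ v hv)
  rw [← h2, ← h3, h1]

/-- Kraft inequality for the code of a grammar transform. -/
lemma kraft_codeLength {Γ : List 𝕏 → Grammar 𝕏} (hΓ : IsGrammarTransform Γ)
    (e : 𝕏 ≃ Fin (Fintype.card 𝕏)) {φ : ℕ → List Bool} (hφ : IsProperNumberCode φ)
    {n : ℕ} (hn : n ≠ 0) :
    ∑ y : Fin n → 𝕏, (1 / 2 : ℝ) ^ (Γ (List.ofFn y)).codeLength e φ ≤ 1 := by
  classical
  have hne : ∀ y : Fin n → 𝕏, List.ofFn y ≠ [] := fun y => by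
    rw [Ne, List.ofFn_eq_nil_iff]; exact hn
  let c : (Fin n → 𝕏) → List Bool := fun y => (Γ (List.ofFn y)).encode e φ
  have hpre : ∀ y z, c y <+: c z → y = z := fun y z h =>
    List.ofFn_injective (eq_of_encode_prefix hΓ e hφ (hne y) (hne z) h)
  have hud : InformationTheory.UniquelyDecodable
      ((Finset.univ.image c : Finset (List Bool)) : Set (List Bool)) := by
    apply uniquelyDecodable_of_prefix_free
    · intro a ha b hb hab
      simp only [Finset.coe_image, Finset.coe_univ, Set.image_univ, Set.mem_range] at ha hb
      obtain ⟨y, rfl⟩ := ha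
      obtain ⟨z, rfl⟩ := hb
      rw [hpre y z hab]
    · intro h
      simp only [Finset.coe_image, Finset.coe_univ, Set.image_univ, Set.mem_range] at h
      obtain ⟨y, hy⟩ := h
      have h1 : (Γ (List.ofFn y)).codeLength e φ = 0 := by
        change (c y).length = 0
        rw [hy]; rfl
      have h2 := (Γ (List.ofFn y)).size_le_codeLength e hφ
      have h3 := (Γ (List.ofFn y)).size_pos
      omega
  have h := InformationTheory.kraft_mcmillan_inequality hud
  rw [Finset.sum_image (fun y _ z _ (hyz : c y = c z) =>
    hpre y z (hyz ▸ List.prefix_refl (c y)))] at h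
  simp only [Fintype.card_bool, Nat.cast_ofNat] at h
  exact h

end Kraft

/-! ### Entropy and expected code length -/

lemma entropy_nonneg {Ω α : Type*} [MeasurableSpace Ω] [Fintype α] (P : Measure Ω)
    [IsProbabilityMeasure P] (Y : Ω → α) : 0 ≤ entropy P Y :=
  Finset.sum_nonneg fun _ _ => Real.negMulLog_nonneg measureReal_nonneg measureReal_le_one

section Entropy

variable {Ω α : Type*} [MeasurableSpace Ω] [Fintype α] [MeasurableSpace α]
  [MeasurableSingletonClass α] (P : Measure Ω) [IsProbabilityMeasure P]

lemma integrable_comp_of_fintype {Y : Ω → α} (hY : Measurable Y) (g : α → ℝ) :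
    Integrable (fun ω => g (Y ω)) P := by
  have : IsProbabilityMeasure (P.map Y) := Measure.isProbabilityMeasure_map hY.aemeasurable
  exact (Integrable.of_finite (μ := P.map Y) (f := g)).comp_measurable hY

lemma integral_comp_eq_sum {Y : Ω → α} (hY : Measurable Y) (g : α → ℝ) :
    ∫ ω, g (Y ω) ∂P = ∑ y, P.real (Y ⁻¹' {y}) * g y := by
  have : IsProbabilityMeasure (P.map Y) := Measure.isProbabilityMeasure_map hY.aemeasurable
  have h := integral_map (μ := P) hY.aemeasurable (f := g)
    (measurable_of_finite g).aestronglyMeasurable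
  rw [← h, integral_fintype Integrable.of_finite]
  refine Finset.sum_congr rfl fun y _ => ?_
  rw [map_measureReal_apply hY (measurableSet_singleton y), smul_eq_mul]

lemma sum_measureReal_preimage {Y : Ω → α} (hY : Measurable Y) :
    ∑ y, P.real (Y ⁻¹' {y}) = 1 := by
  have := integral_comp_eq_sum P hY (fun _ => 1)
  simpa using this.symm

/-- The source coding inequality. -/
lemma entropy_le_integral_length {Y : Ω → α} (hY : Measurable Y) (c : α → ℕ)
    (hc : ∑ y, (1 / 2 : ℝ) ^ c y ≤ 1) :
    entropy P Y ≤ Real.log 2 * ∫ ω, (c (Y ω) : ℝ) ∂P := by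
  rw [integral_comp_eq_sum P hY (fun y => (c y : ℝ)), entropy, Finset.mul_sum]
  have key : ∀ y, Real.negMulLog (P.real (Y ⁻¹' {y})) ≤
      Real.log 2 * (P.real (Y ⁻¹' {y}) * c y) + ((1 / 2 : ℝ) ^ c y - P.real (Y ⁻¹' {y})) := by
    intro y
    set q := P.real (Y ⁻¹' {y})
    have hq : 0 ≤ q := measureReal_nonneg
    rcases hq.eq_or_lt with h0 | h0
    · rw [← h0]; simp
    -- Gibbs' inequality termwise: log t ≤ t - 1 at t = 2^(-c y) / q.
    · have h1 := Real.log_le_sub_one_of_pos (x := (1 / 2 : ℝ) ^ c y / q) (by positivity)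
      rw [Real.log_div (by positivity) h0.ne', Real.log_pow, one_div, Real.log_inv] at h1
      have h2 := mul_le_mul_of_nonneg_left h1 hq
      rw [mul_sub, mul_sub, mul_one, mul_div_cancel₀ _ h0.ne'] at h2
      rw [Real.negMulLog, one_div]
      linarith
  calc _ ≤ ∑ y, (Real.log 2 * (P.real (Y ⁻¹' {y}) * c y) +
        ((1 / 2 : ℝ) ^ c y - P.real (Y ⁻¹' {y}))) := Finset.sum_le_sum fun y _ => key y
    _ ≤ _ := by
      rw [Finset.sum_add_distrib, Finset.sum_sub_distrib, sum_measureReal_preimage P hY]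
      linarith

end Entropy

/-! ### Blocks of a stationary process -/

section StationaryBlocks

variable {Ω 𝕏 : Type*} [MeasurableSpace Ω] [Fintype 𝕏] [MeasurableSpace 𝕏]
  [MeasurableSingletonClass 𝕏] {P : Measure Ω} [IsProbabilityMeasure P] {X : ℤ → Ω → 𝕏}

lemma measurable_block {Ω 𝕏 : Type*} [MeasurableSpace Ω] [MeasurableSpace 𝕏] {X : ℤ → Ω → 𝕏}
    (hX : ∀ i, Measurable (X i)) (t : ℤ) (n : ℕ) : Measurable (block X t n) :=
  measurable_pi_lambda _ fun _ => hX _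

lemma measureReal_block_eq {Ω 𝕏 : Type*} [MeasurableSpace Ω] [MeasurableSpace 𝕏]
    [MeasurableSingletonClass 𝕏] {P : Measure Ω} {X : ℤ → Ω → 𝕏}
    (hX : ∀ i, Measurable (X i)) (hstat : IsStationary P X) (t n : ℕ)
    (w : Fin n → 𝕏) : P.real (block X t n ⁻¹' {w}) = P.real (block X 0 n ⁻¹' {w}) := by
  induction t with
  | zero => rfl
  | succ t ih =>
    rw [← ih]
    have hm : Measurable fun (x : ℤ → 𝕏) (i : Fin n) => x (t + 1 + (i : ℕ)) :=
      measurable_pi_lambda _ fun i => measurable_pi_apply _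
    have hS := hm (measurableSet_singleton w)
    have h1 : Measurable fun ω (i : ℤ) => X (i + 1) ω := measurable_pi_lambda _ fun i => hX _
    have h2 : Measurable fun ω (i : ℤ) => X i ω := measurable_pi_lambda _ fun i => hX _
    have h3 := congrArg (fun μ : Measure (ℤ → 𝕏) => μ.real
      ((fun (x : ℤ → 𝕏) (i : Fin n) => x (t + 1 + (i : ℕ))) ⁻¹' {w})) hstat
    rw [map_measureReal_apply h1 hS, map_measureReal_apply h2 hS] at h3
    have hb : block X ((t + 1 : ℕ) : ℤ) n = fun ω (i : Fin n) => X (t + 1 + (i : ℕ) + 1) ω := by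
      funext ω i
      simp only [block, Nat.cast_add, Nat.cast_one]
      congr 1
      ring
    rw [hb]
    exact h3

lemma integral_block_eq (hX : ∀ i, Measurable (X i)) (hstat : IsStationary P X) (t n : ℕ)
    (g : (Fin n → 𝕏) → ℝ) : ∫ ω, g (block X t n ω) ∂P = ∫ ω, g (block X 0 n ω) ∂P := by
  rw [integral_comp_eq_sum P (measurable_block hX _ _), integral_comp_eq_sum P
    (measurable_block hX _ _)]
  simp_rw [measureReal_block_eq hX hstat]

lemma entropy_block_eq {Ω 𝕏 : Type*} [MeasurableSpace Ω] [Fintype 𝕏] [MeasurableSpace 𝕏]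
    [MeasurableSingletonClass 𝕏] {P : Measure Ω} {X : ℤ → Ω → 𝕏}
    (hX : ∀ i, Measurable (X i)) (hstat : IsStationary P X) (t n : ℕ) :
    entropy P (block X t n) = entropy P (block X 0 n) := by
  unfold entropy
  simp_rw [measureReal_block_eq hX hstat]

lemma ofFn_block_add {Ω 𝕏 : Type*} (X : ℤ → Ω → 𝕏) (m n : ℕ) (ω : Ω) :
    List.ofFn (block X 0 (m + n) ω) = List.ofFn (block X 0 m ω) ++ List.ofFn (block X m n ω) := by
  rw [List.ofFn_add]
  congr 1
  refine congrArg List.ofFn (funext fun i => ?_)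
  simp only [block, Fin.val_natAdd]
  congr 1
  push_cast
  ring

lemma ofFn_block_mul {Ω 𝕏 : Type*} (X : ℤ → Ω → 𝕏) (N K : ℕ) (ω : Ω) :
    List.ofFn (block X 0 (N * K) ω) =
      (List.ofFn fun t : Fin N => List.ofFn (block X ((t * K : ℕ) : ℤ) K ω)).flatten := by
  rw [List.ofFn_mul]
  congr 1
  refine congrArg List.ofFn (funext fun t => congrArg List.ofFn (funext fun i => ?_))
  simp only [block]
  congr 1
  push_cast
  ring

end StationaryBlocks

/-! ### Block grammars -/

section BlockGrammar

variable {𝕏 : Type*} {K M : ℕ}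

/-- The grammar whose secondary nonterminals derive all blocks of length `K`. -/
abbrev blockGrammar (r : (Fin K → 𝕏) ≃ Fin M) (l : List (Fin K → 𝕏)) : Grammar 𝕏 where
  size := M + 1
  size_pos := M.succ_pos
  rhs := Fin.cases (l.map fun y => .nonterminal (r y).succ)
    fun j => (List.ofFn (r.symm j)).map .terminal
  succeeding i j h := by
    induction i using Fin.cases with
    | zero =>
      simp only [Fin.cases_zero, List.mem_map, Symbol.nonterminal.injEq] at h
      obtain ⟨y, -, rfl⟩ := h
      exact Fin.succ_pos _
    | succ i => simp at h

lemma blockGrammar_produces (r : (Fin K → 𝕏) ≃ Fin M) (l : List (Fin K → 𝕏)) :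
    (blockGrammar r l).Produces (l.map List.ofFn).flatten := by
  rw [Grammar.produces_iff, Grammar.expand_eq]
  have h : ∀ y, (blockGrammar r l).expandSymbol (Symbol.nonterminal (r y).succ) = List.ofFn y := by
    intro y
    refine ((blockGrammar r l).expand_eq (r y).succ).trans ?_
    refine (Grammar.expandSymbol_flatMap_terminal _ (List.ofFn (r.symm (r y)))).trans ?_
    simp
  change (l.map fun y => Symbol.nonterminal (r y).succ).flatMap (blockGrammar r l).expandSymbol = _
  rw [List.flatMap_map, List.flatMap_def]
  simp_rw [h]

/-- The first summand is the start rule and depends on the text; the second is the dictionary with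
all marks and is independent of the length of `l`. -/
lemma codeLength_blockGrammar_le [Fintype 𝕏] (e : 𝕏 ≃ Fin (Fintype.card 𝕏)) {φ : ℕ → List Bool}
    (hφ : IsProperNumberCode φ) (r : (Fin K → 𝕏) ≃ Fin M) (l : List (Fin K → 𝕏)) :
    (blockGrammar r l).codeLength e φ ≤
      (l.map fun y => (φ (Fintype.card 𝕏 + 2 + (r y : ℕ))).length).sum +
        (φ (Fintype.card 𝕏 + 1)).length * (M * (K + 1) + 1) := by
  set W := (φ (Fintype.card 𝕏 + 1)).length with hW
  have hsep : ∀ i : Fin (M + 1), Grammar.separatorCost 𝕏 φ (M + 1) i ≤ W :=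
    fun i => Grammar.separatorCost_le hφ i
  rw [Grammar.codeLength_eq]
  change (∑ i : Fin (M + 1), ((((blockGrammar r l).rhs i).map (Grammar.symbolCost e φ i)).sum +
    Grammar.separatorCost 𝕏 φ (M + 1) i)) ≤ _
  rw [Fin.sum_univ_succ]
  have h0 : ((blockGrammar r l).rhs 0).map (Grammar.symbolCost e φ (0 : Fin (M + 1))) =
      l.map fun y => (φ (Fintype.card 𝕏 + 2 + (r y : ℕ))).length := by
    change (l.map fun y => Symbol.nonterminal (r y).succ).map
      (Grammar.symbolCost e φ (0 : Fin (M + 1))) = _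
    rw [List.map_map]
    refine List.map_congr_left fun y _ => ?_
    simp only [Function.comp_apply, Grammar.symbolCost, Grammar.symbolNumber, Fin.val_succ,
      Fin.val_zero, tsub_zero]
    congr 2
    ring
  have h1 : ∀ i : Fin M, ((((blockGrammar r l).rhs i.succ).map
      (Grammar.symbolCost e φ i.succ)).sum + Grammar.separatorCost 𝕏 φ (M + 1) i.succ) ≤
      W * (K + 1) := by
    intro i
    have h2 := Grammar.sum_symbolCost_terminal_le e hφ i.succ (List.ofFn (r.symm i))
    rw [List.length_ofFn] at h2
    rw [mul_add, mul_one]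
    exact add_le_add h2 (hsep _)
  have h2 : ∑ i : Fin M, ((((blockGrammar r l).rhs i.succ).map
      (Grammar.symbolCost e φ i.succ)).sum + Grammar.separatorCost 𝕏 φ (M + 1) i.succ) ≤
      M * (W * (K + 1)) := by
    refine (Finset.sum_le_sum fun i _ => h1 i).trans ?_
    simp
  have h3 : W * (M * (K + 1) + 1) = M * (W * (K + 1)) + W := by ring
  have h4 := congrArg List.sum h0
  have h5 := hsep 0
  rw [h3]
  refine (add_le_add (add_le_add h4.le h5) h2).trans ?_
  omega

end BlockGrammar

/-! ### Ranking by probability -/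

lemma exists_equiv_antitone {α : Type*} [Fintype α] (p : α → ℝ) :
    ∃ r : α ≃ Fin (Fintype.card α), Antitone (p ∘ r.symm) := by
  let e := Fintype.equivFin α
  let f : Fin (Fintype.card α) → ℝ := fun i => - p (e.symm i)
  refine ⟨e.trans (Tuple.sort f).symm, fun i j hij => ?_⟩
  have := Tuple.monotone_sort f hij
  simp only [Function.comp_apply, f] at this
  simpa using this

/-- The `r a + 1` values ranked up to `a` all have probability at least `p a`. Thus log (rank + 1) ≤
-log p, which makes a number code of the rank nearly optimal. -/
lemma rank_mul_le_one {α : Type*} [Fintype α] {p : α → ℝ} (hp : ∀ a, 0 ≤ p a)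
    (hsum : ∑ a, p a = 1) {r : α ≃ Fin (Fintype.card α)} (hr : Antitone (p ∘ r.symm)) (a : α) :
    ((r a : ℕ) + 1 : ℝ) * p a ≤ 1 := by
  calc ((r a : ℕ) + 1 : ℝ) * p a = ∑ i ∈ Finset.Iic (r a), p a := by
        rw [Finset.sum_const, Fin.card_Iic]; simp
    _ ≤ ∑ i ∈ Finset.Iic (r a), p (r.symm i) := Finset.sum_le_sum fun i hi => by
        simpa using hr (Finset.mem_Iic.mp hi)
    _ ≤ ∑ i, p (r.symm i) :=
        Finset.sum_le_sum_of_subset_of_nonneg (Finset.subset_univ _) fun _ _ _ => hp _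
    _ = 1 := (Equiv.sum_comp r.symm p).trans hsum

lemma IsProperNumberCode.length_le_log {φ : ℕ → List Bool} (hφ : IsProperNumberCode φ) (a : ℕ)
    {ε : ℝ} (hε : 0 < ε) : ∃ C : ℝ, 0 ≤ C ∧ ∀ r : ℕ,
      Real.log 2 * (φ (a + r)).length ≤ (1 + ε) * Real.log (r + 1) + C := by
  have hlog2 : 0 < Real.log 2 := Real.log_pos (by norm_num)
  obtain ⟨n₀, hn₀⟩ := eventually_atTop.mp
    (hφ.length_asymp.eventually_lt_const (show (1 : ℝ) < 1 + ε by linarith))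
  have key : ∀ n : ℕ, n₀ ≤ n → 2 ≤ n →
      Real.log 2 * (φ n).length ≤ (1 + ε) * Real.log n := by
    intro n h1 h2
    have h3 := hn₀ n h1
    have hn : 0 < Real.log n := Real.log_pos (by exact_mod_cast h2)
    rw [Real.logb, div_lt_iff₀ (by positivity)] at h3
    have h4 := mul_lt_mul_of_pos_left h3 hlog2
    have h5 : Real.log 2 * ((1 + ε) * (Real.log n / Real.log 2)) = (1 + ε) * Real.log n := by
      field_simp
    linarith
  refine ⟨(1 + ε) * Real.log (a + n₀ + 2), ?_, fun r => ?_⟩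
  · have : 0 ≤ Real.log (a + n₀ + 2) := Real.log_nonneg (by
      have : (0 : ℝ) ≤ a := by positivity
      have : (0 : ℝ) ≤ n₀ := by positivity
      linarith)
    positivity
  -- Monotone codeword lengths move the argument into the range where the asymptotic bound holds.
  have h1 : (φ (a + r)).length ≤ (φ (a + r + n₀ + 2)).length := hφ.length_mono (by omega)
  have h2 := key (a + r + n₀ + 2) (by omega) (by omega)
  have h3 : Real.log ((a + r + n₀ + 2 : ℕ) : ℝ) ≤
      Real.log (r + 1) + Real.log (a + n₀ + 2) := by
    rw [← Real.log_mul (by positivity) (by positivity)]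
    apply Real.log_le_log (by positivity)
    push_cast
    have : (0 : ℝ) ≤ r * (a + n₀ + 1) := by positivity
    nlinarith
  calc Real.log 2 * (φ (a + r)).length ≤ Real.log 2 * (φ (a + r + n₀ + 2)).length := by gcongr
    _ ≤ (1 + ε) * Real.log ((a + r + n₀ + 2 : ℕ) : ℝ) := h2
    _ ≤ (1 + ε) * (Real.log (r + 1) + Real.log (a + n₀ + 2)) := by gcongr
    _ = _ := by ring

/-! ### Universality of admissibly minimal codes -/

section Universal

variable {Ω 𝕏 : Type*} [MeasurableSpace Ω] [Fintype 𝕏] [MeasurableSpace 𝕏]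
  [MeasurableSingletonClass 𝕏] {P : Measure Ω} [IsProbabilityMeasure P] {X : ℤ → Ω → 𝕏}

lemma exists_equiv_integral_le {α : Type*} [Fintype α] [MeasurableSpace α]
    [MeasurableSingletonClass α] {Y : Ω → α} (hY : Measurable Y) {ε C : ℝ} (hε : 0 < ε)
    {c : ℕ → ℝ} (hc : ∀ r : ℕ, c r ≤ (1 + ε) * Real.log (r + 1) + C) :
    ∃ r : α ≃ Fin (Fintype.card α), ∫ ω, c (r (Y ω)) ∂P ≤ (1 + ε) * entropy P Y + C := by
  have hsum := sum_measureReal_preimage P hY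
  obtain ⟨r, hr⟩ := exists_equiv_antitone fun y => P.real (Y ⁻¹' {y})
  refine ⟨r, ?_⟩
  rw [integral_comp_eq_sum P hY (fun y => c (r y))]
  have key : ∀ y, P.real (Y ⁻¹' {y}) * c (r y) ≤
      (1 + ε) * Real.negMulLog (P.real (Y ⁻¹' {y})) + C * P.real (Y ⁻¹' {y}) := by
    intro y
    have hq : 0 ≤ P.real (Y ⁻¹' {y}) := measureReal_nonneg
    have h1 := rank_mul_le_one (p := fun y => P.real (Y ⁻¹' {y})) (fun _ => measureReal_nonneg)
      hsum hr y
    set q := P.real (Y ⁻¹' {y})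
    rcases hq.eq_or_lt with h0 | h0
    · rw [← h0]; simp
    · have h2 := Real.log_le_log (by positivity) h1
      rw [Real.log_mul (by positivity) h0.ne', Real.log_one] at h2
      have h3 := mul_le_mul_of_nonneg_left (hc (r y)) hq
      have h4 := mul_le_mul_of_nonneg_left h2 (mul_nonneg hq (show 0 ≤ 1 + ε by linarith))
      rw [Real.negMulLog]
      nlinarith
  refine (Finset.sum_le_sum fun y _ => key y).trans ?_
  rw [Finset.sum_add_distrib, ← Finset.mul_sum, ← Finset.mul_sum, hsum, mul_one]
  rfl

/-- The order of quantifiers matters: `C`, the overhead per block, does not depend on the block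
length `K`, so it vanishes per letter as `K` grows; `C'`, the dictionary cost, does not depend on
`N`. -/
lemma integral_codeLength_le (hX : ∀ i, Measurable (X i)) (hstat : IsStationary P X)
    {Γ : List 𝕏 → Grammar 𝕏} (e : 𝕏 ≃ Fin (Fintype.card 𝕏)) {φ : ℕ → List Bool}
    (hφ : IsProperNumberCode φ)
    (hmin : ∀ w : List 𝕏, w ≠ [] → ∀ G : Grammar 𝕏, G.Produces w →
      (Γ w).codeLength e φ ≤ G.codeLength e φ) {ε : ℝ} (hε : 0 < ε) :
    ∃ C : ℝ, 0 ≤ C ∧ ∀ K : ℕ, K ≠ 0 → ∃ C' : ℝ, ∀ N : ℕ, N ≠ 0 →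
      Real.log 2 * ∫ ω, ((Γ (List.ofFn (block X 0 (N * K) ω))).codeLength e φ : ℝ) ∂P ≤
        N * ((1 + ε) * entropy P (block X 0 K) + C) + C' := by
  have hlog2 : 0 < Real.log 2 := Real.log_pos (by norm_num)
  obtain ⟨C, hC, hCr⟩ := hφ.length_le_log (Fintype.card 𝕏 + 2) hε
  refine ⟨C, hC, fun K hK => ?_⟩
  obtain ⟨r, hr⟩ := exists_equiv_integral_le (P := P) (measurable_block hX 0 K) hε hCr
  set c : ℕ → ℝ := fun m => Real.log 2 * (φ (Fintype.card 𝕏 + 2 + m)).length with hc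
  set W : ℕ := (φ (Fintype.card 𝕏 + 1)).length *
    (Fintype.card (Fin K → 𝕏) * (K + 1) + 1) with hW
  refine ⟨Real.log 2 * W, fun N hN => ?_⟩
  have hpt : ∀ ω, Real.log 2 * ((Γ (List.ofFn (block X 0 (N * K) ω))).codeLength e φ : ℝ) ≤
      ∑ t : Fin N, c (r (block X ((t * K : ℕ) : ℤ) K ω)) + Real.log 2 * W := by
    intro ω
    let l : List (Fin K → 𝕏) := List.ofFn fun t : Fin N => block X ((t * K : ℕ) : ℤ) K ω
    have hprod := blockGrammar_produces r l
    have hl : (l.map List.ofFn).flatten = List.ofFn (block X 0 (N * K) ω) := by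
      rw [ofFn_block_mul, List.map_ofFn]
      rfl
    rw [hl] at hprod
    have h1 := hmin _ (by
      rw [Ne, List.ofFn_eq_nil_iff]; exact mul_ne_zero hN hK) _ hprod
    have h2 := h1.trans (codeLength_blockGrammar_le e hφ r l)
    have h3 : (l.map fun y => (φ (Fintype.card 𝕏 + 2 + (r y : ℕ))).length).sum =
        ∑ t : Fin N, (φ (Fintype.card 𝕏 + 2 +
          (r (block X ((t * K : ℕ) : ℤ) K ω) : ℕ))).length := by
      rw [List.map_ofFn, List.sum_ofFn]
      rfl
    rw [h3] at h2
    have h4 : ((Γ (List.ofFn (block X 0 (N * K) ω))).codeLength e φ : ℝ) ≤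
        ∑ t : Fin N, ((φ (Fintype.card 𝕏 + 2 +
          (r (block X ((t * K : ℕ) : ℤ) K ω) : ℕ))).length : ℝ) + W := by
      exact_mod_cast h2
    have h5 := mul_le_mul_of_nonneg_left h4 hlog2.le
    rw [mul_add, Finset.mul_sum] at h5
    exact h5
  have hint : ∀ t : Fin N, Integrable (fun ω => c (r (block X ((t * K : ℕ) : ℤ) K ω))) P :=
    fun t => integrable_comp_of_fintype P (measurable_block hX _ _) fun y => c (r y)
  rw [← integral_const_mul]
  refine (integral_mono (integrable_comp_of_fintype P (measurable_block hX 0 (N * K))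
    fun y => Real.log 2 * ((Γ (List.ofFn y)).codeLength e φ : ℝ))
    ((integrable_finsetSum _ fun t _ => hint t).add (integrable_const _)) hpt).trans ?_
  have h6 : ∫ ω, (∑ t : Fin N, c (r (block X ((t * K : ℕ) : ℤ) K ω)) + Real.log 2 * W) ∂P =
      N * ∫ ω, c (r (block X 0 K ω)) ∂P + Real.log 2 * W := by
    rw [integral_add (integrable_finsetSum _ fun t _ => hint t) (integrable_const _),
      integral_finsetSum _ fun t _ => hint t]
    congr 1
    · have : ∀ t : Fin N, ∫ ω, c (r (block X ((t * K : ℕ) : ℤ) K ω)) ∂P =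
          ∫ ω, c (r (block X 0 K ω)) ∂P :=
        fun t => integral_block_eq hX hstat (t * K) K fun y => c (r y)
      rw [Finset.sum_congr rfl fun t _ => this t]
      simp
    · simp
  refine h6.le.trans ?_
  gcongr

end Universal

/-! ### Redundancy along powers of two -/

/-- If the rate of `C` along powers of two is as small as the rate of `H`, the excess of `C` is
infinitely often at least the excess of `H`. -/
lemma frequently_excess_le {H C : ℕ → ℝ} (hH : ∀ k, 0 ≤ H k) (hHC : ∀ k, H k ≤ C k)
    (hdec : ∀ᶠ k in atTop, H (k + 1) ≤ 2 * H k)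
    (huniv : ∀ ε : ℝ, 0 < ε → ∃ c : ℝ, ∀ j : ℕ, ∃ c' : ℝ, ∀ i : ℕ,
      C (i + j) ≤ 2 ^ i * ((1 + ε) * H j + c) + c') :
    ∃ᶠ k in atTop, 2 * H k - H (k + 1) ≤ 2 * C k - C (k + 1) := by
  by_contra hcon
  rw [not_frequently] at hcon
  obtain ⟨k₀, hk₀⟩ := eventually_atTop.mp (hdec.and hcon)
  set h : ℕ → ℝ := fun k => H (k₀ + k) / 2 ^ (k₀ + k) with hh
  set g : ℕ → ℝ := fun k => (C (k₀ + k) - H (k₀ + k)) / 2 ^ (k₀ + k) with hg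
  have h_nonneg : ∀ k, 0 ≤ h k := fun k => div_nonneg (hH _) (by positivity)
  have h_anti : Antitone h := antitone_nat_of_succ_le fun k => by
    have h1 := (hk₀ (k₀ + k) (by omega)).1
    simp only [hh]
    rw [← add_assoc, pow_succ, div_le_div_iff₀ (by positivity) (by positivity)]
    nlinarith [pow_pos (two_pos (α := ℝ)) (k₀ + k)]
  -- The negated conclusion says that C - H more than doubles at each step, so the redundancy per
  -- letter `g` increases.
  have g_mono : StrictMono g := strictMono_nat_of_lt_succ fun k => by
    have h1 := (hk₀ (k₀ + k) (by omega)).2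
    simp only [hg]
    rw [← add_assoc, pow_succ, div_lt_div_iff₀ (by positivity) (by positivity)]
    nlinarith [pow_pos (two_pos (α := ℝ)) (k₀ + k)]
  -- `g 0` is nonnegative but may vanish; `g 1` is positive.
  set δ := g 1 with hδ
  have δ_pos : 0 < δ := lt_of_le_of_lt (div_nonneg (sub_nonneg.mpr (hHC _)) (by positivity))
    (g_mono zero_lt_one)
  have g_ge : ∀ k, 1 ≤ k → δ ≤ g k := fun k hk => g_mono.monotone hk
  have hbdd : BddBelow (Set.range h) := ⟨0, by rintro _ ⟨k, rfl⟩; exact h_nonneg k⟩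
  have hlim := tendsto_atTop_ciInf h_anti hbdd
  set L := ⨅ k, h k with hL
  have hLle : ∀ k, L ≤ h k := fun k => ciInf_le hbdd k
  -- With `h j ≤ h 0`, this ε costs at most δ/8. The other errors are δ/4, δ/8 and δ/8, so in total
  -- the redundancy is at most 5δ/8 < δ.
  obtain ⟨c, hc⟩ := huniv (δ / (8 * (h 0 + 1))) (by have := h_nonneg 0; positivity)
  have hpow : Tendsto (fun j : ℕ => c / 2 ^ (k₀ + j) : ℕ → ℝ) atTop (𝓝 0) := by
    have h1 : Tendsto (fun j : ℕ => (2 : ℝ) ^ (k₀ + j)) atTop atTop :=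
      (tendsto_pow_atTop_atTop_of_one_lt (by norm_num)).comp (tendsto_add_atTop_nat k₀ |>.congr
        fun j => add_comm _ _)
    exact h1.const_div_atTop c
  obtain ⟨j, hj1, hj2⟩ := ((hlim.eventually_lt_const (show L < L + δ / 4 by linarith)).and
    (hpow.eventually_lt_const (show (0 : ℝ) < δ / 8 by linarith))).exists
  obtain ⟨c', hc'⟩ := hc (k₀ + j)
  have hpow' : Tendsto (fun i : ℕ => c' / 2 ^ (i + (k₀ + j)) : ℕ → ℝ) atTop (𝓝 0) := by
    have h1 : Tendsto (fun i : ℕ => (2 : ℝ) ^ (i + (k₀ + j))) atTop atTop :=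
      (tendsto_pow_atTop_atTop_of_one_lt (by norm_num)).comp (tendsto_add_atTop_nat (k₀ + j))
    exact h1.const_div_atTop c'
  obtain ⟨i, hi1, hi2⟩ := ((hpow'.eventually_lt_const (show (0 : ℝ) < δ / 8 by linarith)).and
    (eventually_ge_atTop 1)).exists
  have h1 := hc' i
  have h2 := g_ge (i + j) (by omega)
  have h3 := hLle (i + j)
  have hij : k₀ + (i + j) = i + (k₀ + j) := by ring
  simp only [hg, hh] at h2 h3
  rw [hij] at h2 h3
  rw [sub_div] at h2
  have h4 : C (i + (k₀ + j)) / 2 ^ (i + (k₀ + j)) ≤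
      (1 + δ / (8 * (h 0 + 1))) * h j + c / 2 ^ (k₀ + j) + c' / 2 ^ (i + (k₀ + j)) := by
    rw [div_le_iff₀ (by positivity)]
    refine h1.trans (le_of_eq ?_)
    simp only [hh, pow_add]
    field_simp
  have h5 : δ / (8 * (h 0 + 1)) * h j ≤ δ / 8 := by
    have h6 := h_anti (Nat.zero_le j)
    have h7 := h_nonneg 0
    rw [div_mul_eq_mul_div, div_le_div_iff₀ (by positivity) (by norm_num)]
    nlinarith
  linarith

/-! ### Repeats in finite-energy processes -/

lemma exists_of_not_noRepeat {𝕏 : Type*} {l n : ℕ} {y : Fin n → 𝕏} (hl : 1 ≤ l)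
    (h : ¬ NoRepeat l (List.ofFn y)) : ∃ a b : Fin n, a < b ∧ ∀ i < l,
      ∃ (ha : a + i < n) (hb : b + i < n), y ⟨a + i, ha⟩ = y ⟨b + i, hb⟩ := by
  have key : ∀ (a b : ℕ) (x : List 𝕏), x.length = l → x <+: (List.ofFn y).drop a →
      x <+: (List.ofFn y).drop b → a < b → ∃ a b : Fin n, a < b ∧ ∀ i < l,
      ∃ (ha : a + i < n) (hb : b + i < n), y ⟨a + i, ha⟩ = y ⟨b + i, hb⟩ := by
    intro a b x hx ha hb hab
    have h1 := hb.length_le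
    rw [List.length_drop, List.length_ofFn] at h1
    refine ⟨⟨a, by omega⟩, ⟨b, by omega⟩, hab, fun i hi => ?_⟩
    have ha' : a + i < n := by omega
    have hb' : b + i < n := by omega
    refine ⟨ha', hb', ?_⟩
    have h2 := ha.getElem (i := i) (by omega)
    have h3 := hb.getElem (i := i) (by omega)
    rw [List.getElem_drop, List.getElem_ofFn] at h2 h3
    exact h2.symm.trans h3
  simp only [NoRepeat, not_forall] at h
  obtain ⟨a, b, x, hx, ha, hb, hab⟩ := h
  rcases lt_or_gt_of_ne hab with h1 | h1
  · exact key a b x hx ha hb h1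
  · exact key b a x hx hb ha h1

section Repeats

variable {Ω 𝕏 : Type*} [MeasurableSpace Ω] [Fintype 𝕏] [MeasurableSpace 𝕏]
  [MeasurableSingletonClass 𝕏] {P : Measure Ω} [IsProbabilityMeasure P] {X : ℤ → Ω → 𝕏}

/-- The conditional bound in product form, valid for null events too, with signs of the constants
settled: empty strings give `1 ≤ K`, a one-letter string gives `0 ≤ c`, and `c` is raised to at
least 1/2 so that its logarithm can be divided by. -/
lemma IsFiniteEnergy.exists_bound {Ω 𝕏 : Type*} [MeasurableSpace Ω] [MeasurableSpace 𝕏]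
    [MeasurableSingletonClass 𝕏] {P : Measure Ω} [IsProbabilityMeasure P] {X : ℤ → Ω → 𝕏}
    (hX : ∀ i, Measurable (X i)) (hfe : IsFiniteEnergy P X) :
    ∃ c K : ℝ, 0 < c ∧ c < 1 ∧ 0 ≤ K ∧ ∀ (m k : ℕ) (w : Fin m → 𝕏) (u : Fin k → 𝕏),
      P.real (block X 0 m ⁻¹' {w} ∩ block X m k ⁻¹' {u}) ≤
        K * c ^ k * P.real (block X 0 m ⁻¹' {w}) := by
  obtain ⟨c, K, hc, h⟩ := hfe
  obtain ⟨ω₀⟩ : Nonempty Ω := P.nonempty_of_neZero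
  have huniv : ∀ w : Fin 0 → 𝕏, block X 0 0 ⁻¹' {w} = Set.univ := fun w =>
    Set.eq_univ_of_forall fun ω => Subsingleton.elim _ _
  have hpos : ∀ w : Fin 0 → 𝕏, 0 < P (block X 0 0 ⁻¹' {w}) := fun w => by
    rw [huniv]; simp
  have hK : 1 ≤ K := by
    have h1 := h 0 0 0 Fin.elim0 Fin.elim0 (hpos _)
    have h2 : block X (0 + ((0 : ℕ) : ℤ)) 0 ⁻¹' {Fin.elim0} = Set.univ :=
      Set.eq_univ_of_forall fun ω => Subsingleton.elim _ _
    have := cond_isProbabilityMeasure (μ := P) (hpos Fin.elim0).ne'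
    rw [h2, probReal_univ, pow_zero, mul_one] at h1
    exact h1
  have hc0 : 0 ≤ c := by
    have h1 := measureReal_nonneg.trans (h 0 0 1 Fin.elim0 (fun _ => X 0 ω₀) (hpos _))
    rw [pow_one] at h1
    exact nonneg_of_mul_nonneg_right h1 (by linarith)
  refine ⟨max c (1 / 2), K, by positivity, max_lt hc (by norm_num), by linarith,
    fun m k w u => ?_⟩
  have hA : MeasurableSet (block X 0 m ⁻¹' {w}) :=
    measurable_block hX 0 m (measurableSet_singleton w)
  rcases eq_or_ne (P (block X 0 m ⁻¹' {w})) 0 with h0 | h0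
  · have h1 : P (block X 0 m ⁻¹' {w} ∩ block X m k ⁻¹' {u}) = 0 :=
      measure_mono_null Set.inter_subset_left h0
    simp [Measure.real, h0, h1]
  · have h1 := h 0 m k w u (pos_iff_ne_zero.mpr h0)
    rw [zero_add, Measure.real, cond_apply hA, ENNReal.toReal_mul, ENNReal.toReal_inv] at h1
    have h2 : 0 < P.real (block X 0 m ⁻¹' {w}) :=
      ENNReal.toReal_pos h0 (measure_ne_top _ _)
    have h3 : P.real (block X 0 m ⁻¹' {w} ∩ block X m k ⁻¹' {u}) ≤
        K * c ^ k * P.real (block X 0 m ⁻¹' {w}) := by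
      change (P.real (block X 0 m ⁻¹' {w}))⁻¹ *
        P.real (block X 0 m ⁻¹' {w} ∩ block X m k ⁻¹' {u}) ≤ _ at h1
      rwa [inv_mul_le_iff₀ h2, mul_comm] at h1
    refine h3.trans ?_
    have : c ^ k ≤ max c (1 / 2) ^ k := pow_le_pow_left₀ hc0 (le_max_left _ _) k
    gcongr

/-- A repeat at positions `a < b`, even an overlapping one, makes the block after time `b` a
function of X_1^b: it continues with period `b - a`. Conditionally on X_1^b it is thus one
prescribed string of length `l`. -/
lemma measureReal_repeat_le (hX : ∀ i, Measurable (X i)) {c K : ℝ}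
    (h : ∀ (m k : ℕ) (w : Fin m → 𝕏) (u : Fin k → 𝕏),
      P.real (block X 0 m ⁻¹' {w} ∩ block X m k ⁻¹' {u}) ≤
        K * c ^ k * P.real (block X 0 m ⁻¹' {w})) {a b : ℕ} (hab : a < b) (l : ℕ) :
    P.real {ω | ∀ i < l, X (a + 1 + (i : ℕ)) ω = X (b + 1 + (i : ℕ)) ω} ≤ K * c ^ l := by
  set E := {ω | ∀ i < l, X (a + 1 + (i : ℕ)) ω = X (b + 1 + (i : ℕ)) ω} with hE
  -- The periodic continuation; the index modulo `b - a` stays inside the known block.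
  let u : (Fin b → 𝕏) → Fin l → 𝕏 := fun w i =>
    w ⟨a + i % (b - a), by have := Nat.mod_lt (i : ℕ) (show 0 < b - a by omega); omega⟩
  have hsub : E ⊆ ⋃ w ∈ (Finset.univ : Finset (Fin b → 𝕏)),
      (block X 0 b ⁻¹' {w} ∩ block X b l ⁻¹' {u w}) := by
    intro ω hω
    simp only [Finset.mem_univ, Set.iUnion_true, Set.mem_iUnion]
    refine ⟨block X 0 b ω, rfl, ?_⟩
    have key : ∀ i, i < l → X (b + 1 + (i : ℕ)) ω = X (a + 1 + ((i % (b - a) : ℕ) : ℤ)) ω := by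
      intro i
      induction i using Nat.strong_induction_on with
      | _ i ih =>
        intro hi
        rw [← hω i hi]
        rcases lt_or_ge i (b - a) with h1 | h1
        · rw [Nat.mod_eq_of_lt h1]
        · rw [Nat.mod_eq_sub_mod h1, ← ih (i - (b - a)) (by omega) (by omega)]
          congr 1
          omega
    refine funext fun i => (key i i.isLt).trans ?_
    simp only [block, u]
    congr 1
    push_cast
    ring
  calc P.real E ≤ P.real (⋃ w ∈ (Finset.univ : Finset (Fin b → 𝕏)),
        (block X 0 b ⁻¹' {w} ∩ block X b l ⁻¹' {u w})) := measureReal_mono hsub (measure_ne_top _ _)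
    _ ≤ ∑ w : Fin b → 𝕏, P.real (block X 0 b ⁻¹' {w} ∩ block X b l ⁻¹' {u w}) :=
        measureReal_biUnion_finset_le _ _
    _ ≤ ∑ w : Fin b → 𝕏, K * c ^ l * P.real (block X 0 b ⁻¹' {w}) :=
        Finset.sum_le_sum fun w _ => h b l w (u w)
    _ = K * c ^ l := by
        rw [← Finset.mul_sum, sum_measureReal_preimage P (measurable_block hX 0 b), mul_one]

lemma measureReal_not_noRepeat_le (hX : ∀ i, Measurable (X i)) {c K : ℝ} (hc : 0 < c) (hK : 0 ≤ K)
    (h : ∀ (m k : ℕ) (w : Fin m → 𝕏) (u : Fin k → 𝕏),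
      P.real (block X 0 m ⁻¹' {w} ∩ block X m k ⁻¹' {u}) ≤
        K * c ^ k * P.real (block X 0 m ⁻¹' {w})) {l : ℕ} (hl : 1 ≤ l) (n : ℕ) :
    P.real {ω | ¬ NoRepeat l (List.ofFn (block X 0 n ω))} ≤ (n : ℝ) ^ 2 * (K * c ^ l) := by
  have hsub : {ω | ¬ NoRepeat l (List.ofFn (block X 0 n ω))} ⊆
      ⋃ q ∈ (Finset.univ.filter fun q : Fin n × Fin n => q.1 < q.2),
        {ω | ∀ i < l, X ((q.1 : ℕ) + 1 + (i : ℕ)) ω = X ((q.2 : ℕ) + 1 + (i : ℕ)) ω} := by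
    intro ω hω
    obtain ⟨a, b, hab, hi⟩ := exists_of_not_noRepeat hl hω
    simp only [Finset.mem_filter, Finset.mem_univ, true_and, Set.mem_iUnion]
    refine ⟨(a, b), hab, fun i hil => ?_⟩
    obtain ⟨ha, hb, h1⟩ := hi i hil
    simp only [block] at h1
    have e1 : ∀ j : ℕ, (0 : ℤ) + 1 + ((j + i : ℕ) : ℤ) = j + 1 + i := fun j => by push_cast; ring
    rw [e1, e1] at h1
    exact h1
  calc _ ≤ P.real (⋃ q ∈ (Finset.univ.filter fun q : Fin n × Fin n => q.1 < q.2),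
        {ω | ∀ i < l, X ((q.1 : ℕ) + 1 + (i : ℕ)) ω = X ((q.2 : ℕ) + 1 + (i : ℕ)) ω}) :=
        measureReal_mono hsub (measure_ne_top _ _)
    _ ≤ ∑ q ∈ (Finset.univ.filter fun q : Fin n × Fin n => q.1 < q.2),
        P.real {ω | ∀ i < l, X ((q.1 : ℕ) + 1 + (i : ℕ)) ω = X ((q.2 : ℕ) + 1 + (i : ℕ)) ω} :=
        measureReal_biUnion_finset_le _ _
    _ ≤ ∑ q ∈ (Finset.univ.filter fun q : Fin n × Fin n => q.1 < q.2), K * c ^ l :=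
        Finset.sum_le_sum fun q hq => measureReal_repeat_le hX h (Finset.mem_filter.mp hq).2 l
    _ ≤ ∑ q : Fin n × Fin n, K * c ^ l :=
        Finset.sum_le_sum_of_subset_of_nonneg (Finset.filter_subset _ _)
          fun _ _ _ => by positivity
    _ = (n : ℝ) ^ 2 * (K * c ^ l) := by
        simp [sq]

end Repeats

/-! ### Code excess and vocabulary size. -/

section Vocabulary

variable {Ω 𝕏 : Type*} [MeasurableSpace Ω] [Fintype 𝕏] [MeasurableSpace 𝕏]
  [MeasurableSingletonClass 𝕏] {P : Measure Ω} [IsProbabilityMeasure P] {X : ℤ → Ω → 𝕏}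

/-- The excess of the expected code length is not much larger than the expected vocabulary size. -/
lemma codeLength_excess_le (hX : ∀ i, Measurable (X i)) (hstat : IsStationary P X)
    {Γ : List 𝕏 → Grammar 𝕏} (hΓ : IsGrammarTransform Γ) (e : 𝕏 ≃ Fin (Fintype.card 𝕏))
    {φ : ℕ → List Bool} (hφ : IsProperNumberCode φ)
    (hmin : ∀ w : List 𝕏, w ≠ [] → ∀ G : Grammar 𝕏, G.Produces w →
      (Γ w).codeLength e φ ≤ G.codeLength e φ) {W : ℕ} (hW : W = (φ (Fintype.card 𝕏 + 1)).length)
    {n l : ℕ} (hn : n ≠ 0) (hl : 1 ≤ l) (hl' : l ≤ 2 * n) :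
    2 * ∫ ω, ((Γ (List.ofFn (block X 0 n ω))).codeLength e φ : ℝ) ∂P -
      ∫ ω, ((Γ (List.ofFn (block X 0 (2 * n) ω))).codeLength e φ : ℝ) ∂P ≤
    (W * (l + 1) + (φ (Fintype.card 𝕏 + 1 + W * (2 * n + 1))).length : ℕ) *
      ∫ ω, ((Γ (List.ofFn (block X 0 (2 * n) ω))).vocabularySize : ℝ) ∂P +
    2 * (W * (n + 1)) * P.real {ω | ¬ NoRepeat l (List.ofFn (block X 0 (2 * n) ω))} := by
  classical
  set B : ℕ := W * (l + 1) + (φ (Fintype.card 𝕏 + 1 + W * (2 * n + 1))).length with hB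
  set R : Set Ω := {ω | ¬ NoRepeat l (List.ofFn (block X 0 (2 * n) ω))} with hR
  have hRm : MeasurableSet R :=
    measurable_block hX 0 (2 * n) (Set.toFinite {y | ¬ NoRepeat l (List.ofFn y)}).measurableSet
  have hne : ∀ {m : ℕ} (y : Fin m → 𝕏), m ≠ 0 → List.ofFn y ≠ [] := fun y hm => by
    rw [Ne, List.ofFn_eq_nil_iff]; exact hm
  have htriv : ∀ {m : ℕ} (y : Fin m → 𝕏), m ≠ 0 →
      (Γ (List.ofFn y)).codeLength e φ ≤ W * (m + 1) := fun {m} y hm => by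
    have h1 := (hmin _ (hne y hm) _ (flatGrammar_produces _)).trans
      (codeLength_flatGrammar_le e hφ (List.ofFn y))
    rwa [List.length_ofFn, ← hW] at h1
  have hpt : ∀ ω, ((Γ (List.ofFn (block X 0 n ω))).codeLength e φ : ℝ) +
      ((Γ (List.ofFn (block X n n ω))).codeLength e φ : ℝ) ≤
      ((Γ (List.ofFn (block X 0 (2 * n) ω))).codeLength e φ : ℝ) +
      ((B : ℝ) * ((Γ (List.ofFn (block X 0 (2 * n) ω))).vocabularySize : ℝ) +
        R.indicator (fun _ => (2 * (W * (n + 1)) : ℝ)) ω) := by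
    intro ω
    -- On a long repeat both halves are bounded by the one-rule grammar; otherwise the grammar of
    -- the whole is cut in two.
    by_cases hω : ω ∈ R
    · rw [Set.indicator_of_mem hω]
      have h1 := htriv (block X 0 n ω) hn
      have h2 := htriv (block X n n ω) hn
      have h1' : ((Γ (List.ofFn (block X 0 n ω))).codeLength e φ : ℝ) ≤ W * (n + 1) := by
        exact_mod_cast h1
      have h2' : ((Γ (List.ofFn (block X n n ω))).codeLength e φ : ℝ) ≤ W * (n + 1) := by
        exact_mod_cast h2
      have h3 : (0 : ℝ) ≤ ((Γ (List.ofFn (block X 0 (2 * n) ω))).codeLength e φ : ℝ) := by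
        positivity
      have h4 : (0 : ℝ) ≤
          (B : ℝ) * ((Γ (List.ofFn (block X 0 (2 * n) ω))).vocabularySize : ℝ) := by positivity
      linarith
    · rw [Set.indicator_of_notMem hω, add_zero]
      have hrep : NoRepeat l (List.ofFn (block X 0 (2 * n) ω)) := not_not.mp hω
      -- A deterministic bound on the number of rules makes the code of any nonterminal
      -- logarithmically short.
      have hs : (Γ (List.ofFn (block X 0 (2 * n) ω))).size ≤ W * (2 * n + 1) :=
        (Grammar.size_le_codeLength e hφ _).trans (htriv _ (by omega))
      have hsplit : List.ofFn (block X 0 (2 * n) ω) =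
          List.ofFn (block X 0 n ω) ++ List.ofFn (block X n n ω) := by
        rw [two_mul, ofFn_block_add]
      have hlen : l ≤ (List.ofFn (block X 0 (2 * n) ω)).length := by simpa using hl'
      rw [hsplit] at hrep hs hlen ⊢
      have h1 := codeLength_add_codeLength_le hΓ e hφ hmin (hne (block X 0 n ω) hn)
        (hne (block X n n ω) hn) hl hlen hrep
      have h2 : (φ (Fintype.card 𝕏 + 1 +
          (Γ (List.ofFn (block X 0 n ω) ++ List.ofFn (block X n n ω))).size)).length ≤
          (φ (Fintype.card 𝕏 + 1 + W * (2 * n + 1))).length := hφ.length_mono (by omega)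
      have h3 := h1.trans (Nat.add_le_add_left (Nat.mul_le_mul_left _
        (Nat.add_le_add_left h2 _)) _)
      rw [← hW, ← hB, mul_comm _ B] at h3
      exact_mod_cast h3
  have hi1 := integrable_comp_of_fintype P (measurable_block hX 0 n)
    fun y => ((Γ (List.ofFn y)).codeLength e φ : ℝ)
  have hi2 := integrable_comp_of_fintype P (measurable_block hX n n)
    fun y => ((Γ (List.ofFn y)).codeLength e φ : ℝ)
  have hi3 := integrable_comp_of_fintype P (measurable_block hX 0 (2 * n))
    fun y => ((Γ (List.ofFn y)).codeLength e φ : ℝ)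
  have hi4 := (integrable_comp_of_fintype P (measurable_block hX 0 (2 * n))
    fun y => ((Γ (List.ofFn y)).vocabularySize : ℝ)).const_mul (B : ℝ)
  have hi5 : Integrable (R.indicator fun _ => (2 * (W * (n + 1)) : ℝ)) P :=
    (integrable_const _).indicator hRm
  have h := integral_mono (hi1.add hi2) (hi3.add (hi4.add hi5)) hpt
  have e1 := integral_add hi1 hi2
  have e2 := integral_add hi3 (hi4.add hi5)
  have e3 := integral_add hi4 hi5
  simp only [Pi.add_apply] at h e1 e2 e3
  rw [e1, e2, e3, integral_block_eq hX hstat n n fun y => ((Γ (List.ofFn y)).codeLength e φ : ℝ),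
    integral_const_mul, integral_indicator_const _ hRm, smul_eq_mul] at h
  linarith

/-- The lengths of repeats and number codes are of logarithmic order. -/
lemma exists_log_bound {φ : ℕ → List Bool} (hφ : IsProperNumberCode φ) (a W : ℕ) {A : ℝ}
    (hA : 0 < A) : ∃ C : ℝ, 0 < C ∧ ∀ N : ℕ, 2 ≤ N →
      ((W * (⌈A * Real.log N⌉₊ + 1) + (φ (a + W * (N + 1))).length : ℕ) : ℝ) ≤
        C * Real.log N := by
  have hlog2 : 0 < Real.log 2 := Real.log_pos (by norm_num)
  obtain ⟨C, hC, h⟩ := hφ.length_le_log a one_pos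
  refine ⟨W * (A + 2 / Real.log 2) +
    (4 / Real.log 2 + (2 * Real.log (W + 1) + C) / Real.log 2 / Real.log 2), ?_, fun N hN => ?_⟩
  · have : 0 ≤ Real.log ((W : ℝ) + 1) := Real.log_nonneg (by
      have : (0 : ℝ) ≤ W := by positivity
      linarith)
    positivity
  have hN' : (2 : ℝ) ≤ N := by exact_mod_cast hN
  have hlogN : Real.log 2 ≤ Real.log N := Real.log_le_log (by norm_num) hN'
  have hone : 1 ≤ Real.log N / Real.log 2 := (one_le_div hlog2).mpr hlogN
  have h1 : (⌈A * Real.log N⌉₊ : ℝ) + 1 ≤ (A + 2 / Real.log 2) * Real.log N := by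
    have := Nat.ceil_lt_add_one (show 0 ≤ A * Real.log N by positivity)
    have h2 : (A + 2 / Real.log 2) * Real.log N =
      A * Real.log N + 2 * (Real.log N / Real.log 2) := by ring
    linarith
  have h2 := h (W * (N + 1))
  -- This is W(N + 1) + 1 ≤ (W + 1)N², which uses N ≥ 2.
  have h3 : Real.log (((W * (N + 1) : ℕ) : ℝ) + 1) ≤ Real.log (W + 1) + 2 * Real.log N := by
    have h4 : 2 * Real.log N = Real.log ((N : ℝ) ^ 2) := by rw [Real.log_pow]; norm_num
    rw [h4, ← Real.log_mul (by positivity) (by positivity)]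
    apply Real.log_le_log (by positivity)
    push_cast
    have hW : (0 : ℝ) ≤ W := by positivity
    nlinarith [mul_nonneg hW (show (0 : ℝ) ≤ N ^ 2 - N - 1 by nlinarith)]
  have hWn : 0 ≤ Real.log ((W : ℝ) + 1) := Real.log_nonneg (by
    have : (0 : ℝ) ≤ W := by positivity
    linarith)
  have h5 : ((φ (a + W * (N + 1))).length : ℝ) ≤
      (4 / Real.log 2 + (2 * Real.log (W + 1) + C) / Real.log 2 / Real.log 2) * Real.log N := by
    have h6 : Real.log 2 * (φ (a + W * (N + 1))).length ≤
        4 * Real.log N + (2 * Real.log (W + 1) + C) := by linarith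
    have h7 : (2 * Real.log (W + 1) + C) ≤
        (2 * Real.log (W + 1) + C) * (Real.log N / Real.log 2) :=
      le_mul_of_one_le_right (by positivity) hone
    have h8 : ((φ (a + W * (N + 1))).length : ℝ) ≤ (4 * Real.log N +
        (2 * Real.log (W + 1) + C) * (Real.log N / Real.log 2)) / Real.log 2 := by
      rw [le_div_iff₀ hlog2]
      linarith
    refine h8.trans (le_of_eq ?_)
    field_simp
  push_cast
  rw [add_mul, mul_assoc]
  exact add_le_add (mul_le_mul_of_nonneg_left h1 (by positivity)) (by exact_mod_cast h5)

/-- The exponent 3 absorbs the N² pairs of positions and one more factor N for the trivial code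
length on the exceptional event. -/
lemma pow_ceil_le {c : ℝ} (hc : 0 < c) (hc1 : c < 1) {N : ℕ} (hN : 0 < N) :
    c ^ ⌈3 / (-Real.log c) * Real.log N⌉₊ ≤ ((N : ℝ) ^ 3)⁻¹ := by
  have hlog : Real.log c < 0 := Real.log_neg hc hc1
  have hN' : (0 : ℝ) < N := by exact_mod_cast hN
  rw [← Real.rpow_natCast, ← Real.log_le_log_iff (by positivity) (by positivity),
    Real.log_rpow hc, Real.log_inv, Real.log_pow]
  have h1 := mul_le_mul_of_nonpos_right (Nat.le_ceil (3 / (-Real.log c) * Real.log N)) hlog.le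
  refine h1.trans (le_of_eq ?_)
  have := hlog.ne
  push_cast
  field_simp

lemma eventually_ceil_log_le {A : ℝ} (hA : 0 < A) :
    ∀ᶠ N : ℕ in atTop, ⌈A * Real.log N⌉₊ ≤ N := by
  have h1 := (Real.isLittleO_log_id_atTop.bound (show 0 < 1 / A by positivity)).natCast_atTop
  filter_upwards [h1, eventually_ge_atTop 1] with N hN hN1
  rw [Nat.ceil_le]
  have h2 : 0 ≤ Real.log N := Real.log_nonneg (by exact_mod_cast hN1)
  rw [Real.norm_of_nonneg h2, id, Real.norm_of_nonneg (by positivity)] at hN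
  calc A * Real.log N ≤ A * (1 / A * N) := by gcongr
    _ = N := by field_simp

/-- Infinitely often along powers of two, the code excess is at least the excess entropy. -/
lemma frequently_excessEntropy_le (hX : ∀ i, Measurable (X i)) (hstat : IsStationary P X)
    (hE : ∀ᶠ n : ℕ in atTop, 0 ≤ excessEntropy P X n)
    {Γ : List 𝕏 → Grammar 𝕏} (hΓ : IsGrammarTransform Γ) (e : 𝕏 ≃ Fin (Fintype.card 𝕏))
    {φ : ℕ → List Bool} (hφ : IsProperNumberCode φ)
    (hmin : ∀ w : List 𝕏, w ≠ [] → ∀ G : Grammar 𝕏, G.Produces w →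
      (Γ w).codeLength e φ ≤ G.codeLength e φ) :
    ∃ᶠ k : ℕ in atTop, excessEntropy P X (2 ^ k) ≤ Real.log 2 *
      (2 * ∫ ω, ((Γ (List.ofFn (block X 0 (2 ^ k) ω))).codeLength e φ : ℝ) ∂P -
        ∫ ω, ((Γ (List.ofFn (block X 0 (2 * 2 ^ k) ω))).codeLength e φ : ℝ) ∂P) := by
  set H : ℕ → ℝ := fun k => entropy P (block X 0 (2 ^ k)) with hH
  set C : ℕ → ℝ := fun k => Real.log 2 *
    ∫ ω, ((Γ (List.ofFn (block X 0 (2 ^ k) ω))).codeLength e φ : ℝ) ∂P with hC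
  have hexc : ∀ k : ℕ, excessEntropy P X (2 ^ k) = 2 * H k - H (k + 1) := by
    intro k
    have h2 : H (k + 1) = entropy P (block X 0 (2 * 2 ^ k)) :=
      congrArg (fun m => entropy P (block X 0 m)) (pow_succ' 2 k)
    rw [h2, excessEntropy, entropy_block_eq hX hstat, two_mul (H k)]
  have key := frequently_excess_le (H := H) (C := C) (fun k => entropy_nonneg P _)
    (fun k => entropy_le_integral_length P (measurable_block hX 0 (2 ^ k))
      (fun y => (Γ (List.ofFn y)).codeLength e φ) (kraft_codeLength hΓ e hφ (by positivity)))
    ?_ ?_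
  · refine key.mono fun k hk => ?_
    rw [hexc]
    have h2 : C (k + 1) = Real.log 2 *
        ∫ ω, ((Γ (List.ofFn (block X 0 (2 * 2 ^ k) ω))).codeLength e φ : ℝ) ∂P :=
      congrArg (fun m => Real.log 2 *
        ∫ ω, ((Γ (List.ofFn (block X 0 m ω))).codeLength e φ : ℝ) ∂P) (pow_succ' 2 k)
    refine hk.trans (le_of_eq ?_)
    rw [h2, mul_sub]
    simp only [hC]
    ring
  · have hpow : Tendsto (fun k : ℕ => 2 ^ k) atTop atTop :=
      tendsto_pow_atTop_atTop_of_one_lt one_lt_two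
    filter_upwards [hpow.eventually hE] with k hk
    rw [hexc] at hk
    linarith
  · intro ε hε
    obtain ⟨c, -, hc⟩ := integral_codeLength_le hX hstat e hφ hmin hε
    refine ⟨c, fun j => ?_⟩
    obtain ⟨c', hc'⟩ := hc (2 ^ j) (by positivity)
    refine ⟨c', fun i => ?_⟩
    have := hc' (2 ^ i) (by positivity)
    rw [← pow_add] at this
    exact_mod_cast this

/-- Infinitely often, the expected vocabulary size is at least of order `n ^ β / log n`. -/
lemma exists_frequently_le_integral_vocabularySize (hX : ∀ i, Measurable (X i))
    (hstat : IsStationary P X) (hfe : IsFiniteEnergy P X) {β : ℝ} (hβ₀ : 0 < β) (hβ₁ : β < 1)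
    {x : ℝ} (hx : 0 < x) (hE : ∀ᶠ n : ℕ in atTop, x < excessEntropy P X n / (n : ℝ) ^ β)
    {Γ : List 𝕏 → Grammar 𝕏} (hΓ : IsAdmissiblyMinimal Γ) :
    ∃ δ : ℝ, 0 < δ ∧ ∃ᶠ n : ℕ in atTop, 0 < (n : ℝ) ^ β * (Real.log n)⁻¹ ∧
      δ ≤ (∫ ω, ((Γ (List.ofFn (block X 0 n ω))).vocabularySize : ℝ) ∂P) /
        ((n : ℝ) ^ β * (Real.log n)⁻¹) := by
  obtain ⟨hΓ, e, φ, hφ, hmin⟩ := hΓ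
  have hlog2 : 0 < Real.log 2 := Real.log_pos (by norm_num)
  obtain ⟨c, K, hc, hc1, hK, hrep⟩ := hfe.exists_bound hX
  set W := (φ (Fintype.card 𝕏 + 1)).length with hW
  set A : ℝ := 3 / (-Real.log c) with hA
  have hA_pos : 0 < A := div_pos (by norm_num) (neg_pos.mpr (Real.log_neg hc hc1))
  obtain ⟨B, hB, hBle⟩ := exists_log_bound hφ (Fintype.card 𝕏 + 1) W hA_pos
  have hE' : ∀ᶠ n : ℕ in atTop, x * (n : ℝ) ^ β < excessEntropy P X n := by
    filter_upwards [hE, eventually_gt_atTop 0] with n hn hn0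
    have : (0 : ℝ) < n := by exact_mod_cast hn0
    rwa [lt_div_iff₀ (by positivity)] at hn
  have hE0 : ∀ᶠ n : ℕ in atTop, 0 ≤ excessEntropy P X n := by
    filter_upwards [hE'] with n hn
    exact le_trans (by positivity) hn.le
  have hfreq := frequently_excessEntropy_le hX hstat hE0 hΓ e hφ hmin
  have hpow : Tendsto (fun k : ℕ => 2 ^ k) atTop atTop :=
    tendsto_pow_atTop_atTop_of_one_lt one_lt_two
  have hpow2 : Tendsto (fun k : ℕ => 2 * 2 ^ k) atTop atTop :=
    hpow.const_mul_atTop' two_pos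
  -- The exceptional event contributes a constant, eventually at most half of the excess entropy
  -- bound.
  have hlarge : ∀ᶠ n : ℕ in atTop, Real.log 2 * (2 * W * K) ≤ x / 2 * (n : ℝ) ^ β := by
    have : Tendsto (fun n : ℕ => x / 2 * (n : ℝ) ^ β) atTop atTop :=
      ((tendsto_rpow_atTop hβ₀).comp tendsto_natCast_atTop_atTop).const_mul_atTop (by positivity)
    exact this.eventually_ge_atTop _
  -- In the 4, one factor 2 is the half lost to repeats and the other comes from (2n)^β ≤ 2n^β; log
  -- 2 converts bits to nats. The good indices are the doubled lengths 2 · 2^k.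
  refine ⟨x / (4 * (Real.log 2 * B)), by positivity, hpow2.frequently ?_⟩
  refine (hfreq.and_eventually ((hpow.eventually (hE'.and (hlarge.and (eventually_ge_atTop 1)))).and
    (hpow2.eventually (eventually_ceil_log_le hA_pos)))).mono ?_
  rintro k ⟨hk, ⟨hk1, hk2, hk3⟩, hk4⟩
  set n : ℕ := 2 ^ k with hn
  set l : ℕ := ⌈A * Real.log (2 * n : ℕ)⌉₊ with hl
  set v : ℝ := ∫ ω, ((Γ (List.ofFn (block X 0 (2 * n) ω))).vocabularySize : ℝ) ∂P with hv
  have hv0 : 0 ≤ v := integral_nonneg fun ω => by positivity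
  have hnR : (1 : ℝ) ≤ n := by exact_mod_cast hk3
  have hlogN : 0 < Real.log (2 * n : ℕ) := Real.log_pos (by push_cast; linarith)
  have hl1 : 1 ≤ l := Nat.one_le_ceil_iff.mpr (by positivity)
  have h1 := codeLength_excess_le hX hstat hΓ e hφ hmin hW (n := n) (by omega) hl1 hk4
  have h2 := measureReal_not_noRepeat_le hX hc hK hrep hl1 (2 * n)
  have h3 : c ^ l ≤ (((2 * n : ℕ) : ℝ) ^ 3)⁻¹ := pow_ceil_le hc hc1 (by omega)
  have h4 := hBle (2 * n) (by omega)
  have h5 : (2 * (W * (n + 1)) : ℝ) *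
      P.real {ω | ¬ NoRepeat l (List.ofFn (block X 0 (2 * n) ω))} ≤ 2 * W * K := by
    have h6 : P.real {ω | ¬ NoRepeat l (List.ofFn (block X 0 (2 * n) ω))} ≤
        K / (2 * n : ℕ) := by
      refine h2.trans ?_
      calc ((2 * n : ℕ) : ℝ) ^ 2 * (K * c ^ l)
          ≤ ((2 * n : ℕ) : ℝ) ^ 2 * (K * (((2 * n : ℕ) : ℝ) ^ 3)⁻¹) := by gcongr
        _ = K / (2 * n : ℕ) := by
          have : ((2 * n : ℕ) : ℝ) ≠ 0 := by push_cast; positivity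
          field_simp
    calc (2 * (W * (n + 1)) : ℝ) *
        P.real {ω | ¬ NoRepeat l (List.ofFn (block X 0 (2 * n) ω))}
        ≤ (2 * (W * (n + 1)) : ℝ) * (K / (2 * n : ℕ)) := by gcongr
      _ = 2 * W * K * ((n + 1) / (2 * n : ℕ)) := by ring
      _ ≤ 2 * W * K * 1 := by
        gcongr
        rw [div_le_one (by push_cast; positivity)]
        push_cast
        linarith
      _ = 2 * W * K := mul_one _
  have h7 : x * (n : ℝ) ^ β ≤ Real.log 2 * (B * Real.log (2 * n : ℕ) * v + 2 * W * K) := by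
    refine hk1.le.trans (hk.trans ?_)
    gcongr
    refine h1.trans ?_
    gcongr
  have h8 : x / 2 * (n : ℝ) ^ β ≤ Real.log 2 * (B * Real.log (2 * n : ℕ) * v) := by linarith
  have h9 : ((2 * n : ℕ) : ℝ) ^ β ≤ 2 * (n : ℝ) ^ β := by
    push_cast
    rw [Real.mul_rpow (by norm_num) (by positivity)]
    gcongr
    calc (2 : ℝ) ^ β ≤ 2 ^ (1 : ℝ) := Real.rpow_le_rpow_of_exponent_le (by norm_num) hβ₁.le
      _ = 2 := Real.rpow_one 2
  have hpos : 0 < ((2 * n : ℕ) : ℝ) ^ β := Real.rpow_pos_of_pos (by push_cast; positivity) _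
  refine ⟨by positivity, ?_⟩
  rw [le_div_iff₀ (by positivity), ← div_eq_mul_inv, div_mul_div_comm, div_le_iff₀ (by positivity)]
  calc x * ((2 * n : ℕ) : ℝ) ^ β ≤ x * (2 * (n : ℝ) ^ β) := by gcongr
    _ = 4 * (x / 2 * (n : ℝ) ^ β) := by ring
    _ ≤ 4 * (Real.log 2 * (B * Real.log (2 * n : ℕ) * v)) := by gcongr
    _ = v * (4 * (Real.log 2 * B) * Real.log (2 * n : ℕ)) := by ring

end Vocabulary

/-! ### Jensen's inequality and the conclusion. -/

lemma rpow_integral_le {Ω : Type*} [MeasurableSpace Ω] {P : Measure Ω} [IsProbabilityMeasure P]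
    {f : Ω → ℝ} {p : ℝ} (hp : 1 ≤ p) (hf0 : ∀ ω, 0 ≤ f ω) (hf : Integrable f P)
    (hfp : Integrable (fun ω => f ω ^ p) P) : (∫ ω, f ω ∂P) ^ p ≤ ∫ ω, f ω ^ p ∂P :=
  (convexOn_rpow hp).map_integral_le
    (Real.continuous_rpow_const (by linarith)).continuousOn isClosed_Ici
    (Eventually.of_forall hf0) hf hfp

end Herdan

theorem theorem3 {Ω : Type*} [MeasurableSpace Ω] (P : Measure Ω) [IsProbabilityMeasure P]
    {𝕏 : Type*} [Fintype 𝕏] [MeasurableSpace 𝕏] [MeasurableSingletonClass 𝕏]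
    (X : ℤ → Ω → 𝕏) (hX : ∀ i, Measurable (X i))
    (hstat : Herdan.IsStationary P X) (hfe : Herdan.IsFiniteEnergy P X)
    (β : ℝ) (hβ₀ : 0 < β) (hβ₁ : β < 1)
    (hE : 0 < liminf (fun n : ℕ =>
      ((Herdan.excessEntropy P X n / (n : ℝ) ^ β : ℝ) : EReal)) atTop)
    (p : ℝ) (hp : 1 < p)
    (Γ : List 𝕏 → Herdan.Grammar 𝕏) (hΓ : Herdan.IsAdmissiblyMinimal Γ) :
    0 < limsup (fun n : ℕ =>
      ((∫ ω, (((Γ (List.ofFn (Herdan.block X 0 n ω))).vocabularySize : ℝ) /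
        ((n : ℝ) ^ β * (Real.log n)⁻¹)) ^ p ∂P : ℝ) : EReal)) atTop := by
  obtain ⟨x, hx0, hx⟩ := EReal.lt_iff_exists_real_btwn.mp hE
  have hE' : ∀ᶠ n : ℕ in atTop, x < Herdan.excessEntropy P X n / (n : ℝ) ^ β := by
    filter_upwards [eventually_lt_of_lt_liminf hx] with n hn
    exact EReal.coe_lt_coe_iff.mp hn
  obtain ⟨δ, hδ, hfreq⟩ := Herdan.exists_frequently_le_integral_vocabularySize hX hstat hfe hβ₀ hβ₁
    (EReal.coe_pos.mp hx0) hE' hΓ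
  -- Jensen's inequality turns the lower bound δ on the normalized mean into δ^p on the p-th moment,
  -- infinitely often.
  refine lt_of_lt_of_le (EReal.coe_pos.mpr (Real.rpow_pos_of_pos hδ p))
    (le_limsup_of_frequently_le (hfreq.mono ?_))
  rintro n ⟨hn, hδn⟩
  rw [EReal.coe_le_coe_iff]
  refine (Real.rpow_le_rpow hδ.le hδn (by linarith)).trans ?_
  rw [← integral_div]
  have hb := Herdan.measurable_block hX 0 n
  exact Herdan.rpow_integral_le hp.le (fun ω => by positivity)
    (Herdan.integrable_comp_of_fintype P hb fun y =>
      ((Γ (List.ofFn y)).vocabularySize : ℝ) / ((n : ℝ) ^ β * (Real.log n)⁻¹))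
    (Herdan.integrable_comp_of_fintype P hb fun y =>
      (((Γ (List.ofFn y)).vocabularySize : ℝ) / ((n : ℝ) ^ β * (Real.log n)⁻¹)) ^ p)
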